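/- Let $(M,g)$ be a closed (i.e. compact, connected, without boundary), oriented, smooth Riemannian $3$-manifold with scalar curvature $s_g$, and let $\sigma$ be a $\mathrm{spin}^c$ structure on $M$, that is, a principal $\mathrm{Spin}^c_3$-bundle $P$ with a $\mathrm{Spin}^c_3$-equivariant bundle map to the bundle of oriented orthonormal frames of $M$. Let $S=P\times_\rho\mathbb C^2$ be its spinor bundle, where $\rho$ is the spin representation with Clifford multiplication $c(e_j)=-i\sigma_j$ ($\sigma_j$ the Pauli matrices, $(e_1,e_2,e_3)$ an oriented orthonormal basis), and let $L$ be the canonical line bundle, associated with $P$ by $[h,z]\mapsto z^2$ for $h\in\mathrm{Spin}_3$, $z\in U(1)$. For a spinor $\psi$ (a section of $S$) and a Hermitian connection $A$ on $L$ with curvature $F_A$, let $\nabla^A$ be the connection on $S$ induced by the Levi-Civita connection and $A$, let $\mathcal D_A=\sum_j c(e_j)\nabla^A_{e_j}$ be the $\mathrm{spin}^c$ Dirac operator, and put $q(\psi)=-\frac12\sum_j\langle c(e_j)\psi,\psi\rangle e^j$, with $\langle\cdot,\cdot\rangle$ complex linear in the first entry. The pair $(\psi,A)$ is called a Seiberg--Witten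 monopole if $$\mathcal D_A\psi=0,\qquad *F_A=\tfrac12 q(\psi),$$ and reducible if it is fixed by some gauge transformation $\gamma\in C^\infty(M,U(1))$, $\gamma\ne 1$, acting by $\gamma\cdot(\psi,A)=(\gamma^{-1}\psi,\,A+2\gamma^{-1}d\gamma)$. If $(\psi,A)$ is a Seiberg--Witten monopole such that $\psi$ and $A$ are of class $C^2$, then $$\|\psi\|_\infty^2\le\max\bigl\{0,\max_{x\in M}(-2s_g(x))\bigr\}=\max\bigl\{0,-2\min_{x\in M}s_g(x)\bigr\}.$$ In particular, if $s_g\ge0$ on $M$, then every $C^2$ Seiberg--Witten monopole $(\psi,A)$ satisfies $\psi\equiv0$ and is reducible. -/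

import Mathlib

open scoped Manifold ContDiff Bundle TensorProduct

noncomputable section

namespace SeibergWitten

/-! ## Three-dimensional Clifford algebra, `Spin^c` and the spin representation -/

/-- The Euclidean space `ℝ³`. -/
abbrev E3 : Type := EuclideanSpace ℝ (Fin 3)

/-- The spinor module `Δ = ℂ²` with its standard Hermitian metric. -/
abbrev Spin2 : Type := EuclideanSpace ℂ (Fin 2)

/-- The standard orthonormal basis `e₁, e₂, e₃` of `ℝ³` (indexed by `0, 1, 2`). -/
def stdVec (k : Fin 3) : E3 := EuclideanSpace.single k 1

/-- The quadratic form `v ↦ -|v|²`, so that `v * w + w * v = -2⟨v, w⟩` in its Clifford algebra. -/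
def Q3 : QuadraticForm ℝ E3 := -(LinearMap.BilinMap.toQuadraticMap (innerₗ E3))

lemma Q3_apply (v : E3) : Q3 v = -‖v‖ ^ 2 := by
  simp [Q3]

/-- The real Clifford algebra of `ℝ³`. -/
abbrev Cl3 : Type := CliffordAlgebra Q3

/-- The complexified Clifford algebra of `ℝ³`. -/
abbrev ClC3 : Type := ℂ ⊗[ℝ] Cl3

/-- The inclusion of `ℝ³` into the complexified Clifford algebra. -/
def clVec : E3 →ₗ[ℝ] ClC3 :=
  (Algebra.TensorProduct.includeRight : Cl3 →ₐ[ℝ] ClC3).toLinearMap ∘ₗ CliffordAlgebra.ι Q3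

/-- The group `Spin^c(3)`: the subgroup of the units of the complexified Clifford algebra
generated by `Spin(3)` and `U(1)`. -/
def SpinC3 : Subgroup ClC3ˣ :=
  Subgroup.closure
    ({u | ∃ x ∈ spinGroup Q3, (u : ClC3) = (1 : ℂ) ⊗ₜ[ℝ] x} ∪
      {u | ∃ z : Circle, (u : ClC3) = (z : ℂ) ⊗ₜ[ℝ] (1 : Cl3)})

/-- The Pauli matrices. -/
def pauli : Fin 3 → Matrix (Fin 2) (Fin 2) ℂ :=
  ![!![0, 1; 1, 0], !![0, -Complex.I; Complex.I, 0], !![1, 0; 0, -1]]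

/-- Clifford multiplication `c : ℝ³ → End(ℂ²)`, `c(e_j) = -i σ_j`. -/
def cliffordMul : E3 →ₗ[ℝ] Matrix (Fin 2) (Fin 2) ℂ where
  toFun v := ∑ j, v j • ((-Complex.I) • pauli j)
  map_add' v w := by simp only [PiLp.add_apply, add_smul, Finset.sum_add_distrib]
  map_smul' r v := by
    simp only [PiLp.smul_apply, smul_eq_mul, mul_smul, Finset.smul_sum, RingHom.id_apply]

lemma cliffordMul_sq (v : E3) :
    cliffordMul v * cliffordMul v = algebraMap ℝ (Matrix (Fin 2) (Fin 2) ℂ) (Q3 v) := by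
  rw [Q3_apply, EuclideanSpace.norm_sq_eq]
  ext i j
  fin_cases i <;> fin_cases j <;>
    simp [cliffordMul, pauli, Fin.sum_univ_three, Matrix.mul_apply, Matrix.algebraMap_matrix_apply]
      <;> ring_nf <;> simp [Complex.I_sq] <;> ring

lemma spinRep_commute (z : ℂ) (y : Cl3) :
    Commute (Algebra.ofId ℂ (Matrix (Fin 2) (Fin 2) ℂ) z)
      (CliffordAlgebra.lift Q3 ⟨cliffordMul, cliffordMul_sq⟩ y) :=
  Algebra.commutes z _

/-- The irreducible representation of the complexified Clifford algebra on `ℂ²` which extends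
`c(e_j) = -i σ_j`; its restriction to `Spin^c(3)` is the spin representation. -/
def spinRep : ClC3 →ₐ[ℂ] Matrix (Fin 2) (Fin 2) ℂ :=
  Algebra.TensorProduct.lift (Algebra.ofId ℂ _)
    (CliffordAlgebra.lift Q3 ⟨cliffordMul, cliffordMul_sq⟩)
    spinRep_commute

lemma spinRep_clVec (v : E3) : spinRep (clVec v) = cliffordMul v := by
  have h : clVec v = (1 : ℂ) ⊗ₜ[ℝ] CliffordAlgebra.ι Q3 v := rfl
  rw [h, spinRep, Algebra.TensorProduct.lift_tmul]
  simp

/-- A matrix acting on a spinor. -/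
def matAct (T : Matrix (Fin 2) (Fin 2) ℂ) : Spin2 →ₗ[ℂ] Spin2 := Matrix.toEuclideanLin T

/-- Conjugation by an element of `Spin^c(3)` leaves `ℝ³` invariant. -/
lemma SpinC3.exists_conj (g : SpinC3) (v : E3) :
    ∃ w, clVec w = ((g : ClC3ˣ) : ClC3) * clVec v * (((g : ClC3ˣ)⁻¹ : ClC3ˣ) : ClC3) := by
  have hspin : ∀ u : ClC3ˣ, (∃ x ∈ spinGroup Q3, (u : ClC3) = (1 : ℂ) ⊗ₜ[ℝ] x) →
      ∀ v, ∃ w, clVec w = (u : ClC3) * clVec v * ((u⁻¹ : ClC3ˣ) : ClC3) := by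
    rintro u ⟨x, hx, hu⟩ v
    have hinv : ((u⁻¹ : ClC3ˣ) : ClC3) = (1 : ℂ) ⊗ₜ[ℝ] star x := by
      refine Units.inv_eq_of_mul_eq_one_right ?_
      rw [hu, Algebra.TensorProduct.tmul_mul_tmul, spinGroup.mul_star_self_of_mem hx, one_mul]
      rfl
    let ux : Cl3ˣ := ⟨x, star x, spinGroup.mul_star_self_of_mem hx,
      spinGroup.star_mul_self_of_mem hx⟩
    obtain ⟨w, hw⟩ := spinGroup.conjAct_smul_ι_mem_range_ι (x := ux) hx v
    refine ⟨w, ?_⟩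
    rw [ConjAct.units_smul_def, ConjAct.ofConjAct_toConjAct] at hw
    have h : ∀ v, clVec v = (1 : ℂ) ⊗ₜ[ℝ] CliffordAlgebra.ι Q3 v := fun v => rfl
    rw [h, h, hu, hinv, hw, Algebra.TensorProduct.tmul_mul_tmul,
      Algebra.TensorProduct.tmul_mul_tmul, one_mul, one_mul]
    rfl
  have hcirc : ∀ u : ClC3ˣ, (∃ z : Circle, (u : ClC3) = (z : ℂ) ⊗ₜ[ℝ] (1 : Cl3)) →
      ∀ v, ∃ w, clVec w = (u : ClC3) * clVec v * ((u⁻¹ : ClC3ˣ) : ClC3) := by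
    rintro u ⟨z, hu⟩ v
    refine ⟨v, ?_⟩
    have hcomm : (u : ClC3) * clVec v = clVec v * (u : ClC3) := by
      have h : clVec v = (1 : ℂ) ⊗ₜ[ℝ] CliffordAlgebra.ι Q3 v := rfl
      rw [hu, h, Algebra.TensorProduct.tmul_mul_tmul, Algebra.TensorProduct.tmul_mul_tmul]
      simp
    rw [hcomm, mul_assoc, Units.mul_inv, mul_one]
  obtain ⟨g, hg⟩ := g
  simp only
  unfold SpinC3 at hg
  induction hg using Subgroup.closure_induction'' generalizing v with
  | mem u hu => exact hu.elim (fun h => hspin u h v) (fun h => hcirc u h v)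
  | inv_mem u hu =>
    rcases hu with ⟨x, hx, hu⟩ | ⟨z, hu⟩
    · refine hspin _ ⟨star x, spinGroup.star_mem hx, ?_⟩ v
      refine Units.inv_eq_of_mul_eq_one_right ?_
      rw [hu, Algebra.TensorProduct.tmul_mul_tmul, spinGroup.mul_star_self_of_mem hx, one_mul]
      rfl
    · refine hcirc _ ⟨z⁻¹, ?_⟩ v
      refine Units.inv_eq_of_mul_eq_one_right ?_
      rw [hu, Algebra.TensorProduct.tmul_mul_tmul, ← Circle.coe_mul, mul_inv_cancel, mul_one]
      rfl
  | one => exact ⟨v, by simp⟩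
  | mul a b _ _ ha hb =>
    obtain ⟨w, hw⟩ := hb v
    obtain ⟨w', hw'⟩ := ha w
    refine ⟨w', ?_⟩
    rw [hw', hw, mul_inv_rev, Units.val_mul, Units.val_mul]
    simp only [mul_assoc]

/-- The homomorphism `ξ₀ᶜ : Spin^c(3) → SO(3)`, `ξ₀ᶜ(g) v = g v g⁻¹`. -/
def xi (g : SpinC3) (v : E3) : E3 := (SpinC3.exists_conj g v).choose

lemma clVec_xi (g : SpinC3) (v : E3) :
    clVec (xi g v) = ((g : ClC3ˣ) : ClC3) * clVec v * (((g : ClC3ˣ)⁻¹ : ClC3ˣ) : ClC3) :=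
  (SpinC3.exists_conj g v).choose_spec

/-- The homomorphism `ζᶜ : Spin^c(3) → U(1)`, `[s, z] ↦ z²` for `s ∈ Spin(3)`, `z ∈ U(1)`, written
as the determinant of the spin representation (see `zeta_eq_sq`). -/
def zeta (g : SpinC3) : ℂ := (spinRep ((g : ClC3ˣ) : ClC3)).det

lemma zeta_eq_sq (g : SpinC3) (x : Cl3) (hx : x ∈ spinGroup Q3) (z : Circle)
    (hg : ((g : ClC3ˣ) : ClC3) = (z : ℂ) ⊗ₜ[ℝ] x) : zeta g = (z : ℂ) ^ 2 := by
  let d : Cl3 →* ℂ := (Matrix.detMonoidHom.comp (spinRep : ClC3 →* Matrix (Fin 2) (Fin 2) ℂ)).comp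
    ((Algebra.TensorProduct.includeRight : Cl3 →ₐ[ℝ] ClC3) : Cl3 →* ClC3)
  have hd : ∀ y, d y = (spinRep ((1 : ℂ) ⊗ₜ[ℝ] y)).det := fun y => rfl
  have hvec : ∀ v : E3, d (CliffordAlgebra.ι Q3 v) = ((‖v‖ ^ 2 : ℝ) : ℂ) := by
    intro v
    have h : (1 : ℂ) ⊗ₜ[ℝ] CliffordAlgebra.ι Q3 v = clVec v := rfl
    rw [hd, h, spinRep_clVec, EuclideanSpace.norm_sq_eq]
    simp [cliffordMul, pauli, Fin.sum_univ_three, Matrix.det_fin_two]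
    ring_nf
    simp [Complex.I_sq]
    ring
  have hlip : ∀ u ∈ lipschitzGroup Q3, ∃ r : ℝ, 0 < r ∧ d (u : Cl3) = r ∧
      d (star (u : Cl3)) = r := by
    intro u hu
    unfold lipschitzGroup at hu
    induction hu using Subgroup.closure_induction with
    | mem u hu =>
      obtain ⟨v, hv⟩ := hu
      refine ⟨‖v‖ ^ 2, ?_, ?_, ?_⟩
      · have hv0 : v ≠ 0 := by
          rintro rfl
          rw [map_zero] at hv
          exact u.ne_zero hv.symm
        positivity
      · rw [← hv, hvec]
      · rw [← hv, CliffordAlgebra.star_ι, ← map_neg, hvec, norm_neg]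
    | one => exact ⟨1, one_pos, by simp, by simp⟩
    | mul a b _ _ ha hb =>
      obtain ⟨r, hr, h1, h2⟩ := ha
      obtain ⟨s, hs, h3, h4⟩ := hb
      refine ⟨r * s, mul_pos hr hs, ?_, ?_⟩
      · rw [Units.val_mul, map_mul, h1, h3, Complex.ofReal_mul]
      · rw [Units.val_mul, star_mul, map_mul, h2, h4, Complex.ofReal_mul, mul_comm]
    | inv a _ ha =>
      obtain ⟨r, hr, h1, h2⟩ := ha
      have hr' : (r : ℂ) ≠ 0 := by exact_mod_cast hr.ne'
      refine ⟨r⁻¹, inv_pos.2 hr, ?_, ?_⟩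
      · have h := congrArg d (Units.mul_inv a)
        rw [map_mul, map_one, h1] at h
        rw [Complex.ofReal_inv]
        exact eq_inv_of_mul_eq_one_right h
      · have h := congrArg (fun y => d (star y)) (Units.inv_mul a)
        simp only [star_mul, star_one, map_mul, map_one, h2] at h
        rw [Complex.ofReal_inv]
        exact eq_inv_of_mul_eq_one_right h
  have hdx : d x = 1 := by
    let ux : Cl3ˣ := ⟨x, star x, spinGroup.mul_star_self_of_mem hx,
      spinGroup.star_mul_self_of_mem hx⟩
    obtain ⟨r, hr, h1, h2⟩ := hlip ux (spinGroup.units_mem_lipschitzGroup (x := ux) hx)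
    have h1' : d x = r := h1
    have h2' : d (star x) = r := h2
    have h := congrArg d (spinGroup.mul_star_self_of_mem hx)
    rw [map_mul, map_one, h1', h2'] at h
    have h' : r * r = 1 := by exact_mod_cast h
    have hr1 : r = 1 := by nlinarith
    rw [h1', hr1, Complex.ofReal_one]
  have hz : (z : ℂ) ⊗ₜ[ℝ] x = (z : ℂ) • ((1 : ℂ) ⊗ₜ[ℝ] x) := by
    rw [TensorProduct.smul_tmul', smul_eq_mul, mul_one]
  rw [zeta, hg, hz, map_smul, Matrix.det_smul, ← hd, hdx]
  simp

/-! ## Riemannian geometry of a 3-manifold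

`M` is a smooth 3-manifold without boundary; its Riemannian metric is the inner product that
`RiemannianBundle` puts on the tangent spaces. -/

section Riemannian

variable {M : Type*} [TopologicalSpace M] [ChartedSpace E3 M]

instance (x : M) : FiniteDimensional ℝ (TangentSpace (𝓡 3) x) :=
  inferInstanceAs (FiniteDimensional ℝ E3)

/-- The complex valued covectors at `x`. -/
abbrev CCovector (x : M) : Type := TangentSpace (𝓡 3) x →L[ℝ] ℂ

variable [IsManifold (𝓡 3) ∞ M]

/-- An orientation of `M`: an orientation of every tangent space such that near every point there
is a smooth frame which is positively oriented at each point. -/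
structure ManifoldOrientation (M : Type*) [TopologicalSpace M] [ChartedSpace E3 M]
    [IsManifold (𝓡 3) ∞ M] where
  /-- The orientation of the tangent space at a point. -/
  at_point (x : M) : Orientation ℝ (TangentSpace (𝓡 3) x) (Fin 3)
  locally_framed (x : M) : ∃ (U : Set M) (e : Fin 3 → (y : M) → TangentSpace (𝓡 3) y)
    (he : IsLocalFrameOn (𝓡 3) E3 ∞ e U), IsOpen U ∧ x ∈ U ∧
      ∀ y, ∀ hy : y ∈ U, (he.toBasisAt hy).orientation = at_point y

variable [Bundle.RiemannianBundle (fun x : M ↦ TangentSpace (𝓡 3) x)]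

/-- The right-hand side of the Koszul formula, i.e. `⟨∇_X Y, Z⟩` for the Levi-Civita connection. -/
def koszul (X Y Z : (x : M) → TangentSpace (𝓡 3) x) (x : M) : ℝ :=
  (1 / 2) *
    (mvfderiv (𝓡 3) (fun y ↦ inner ℝ (Y y) (Z y)) x (X x)
      + mvfderiv (𝓡 3) (fun y ↦ inner ℝ (X y) (Z y)) x (Y x)
      - mvfderiv (𝓡 3) (fun y ↦ inner ℝ (X y) (Y y)) x (Z x)
      + inner ℝ (VectorField.mlieBracket (𝓡 3) X Y x) (Z x)
      - inner ℝ (VectorField.mlieBracket (𝓡 3) X Z x) (Y x)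
      - inner ℝ (VectorField.mlieBracket (𝓡 3) Y Z x) (X x))

/-- The Levi-Civita covariant derivative `∇_X Y` of differentiable vector fields: the vector field
determined by the Koszul formula. At each point it is expanded in an orthonormal basis of the
tangent space, whose members are extended to smooth vector fields near the point. -/
def leviCivita (X Y : (x : M) → TangentSpace (𝓡 3) x) (x : M) : TangentSpace (𝓡 3) x :=
  ∑ i, koszul X Y (FiberBundle.extend E3 (stdOrthonormalBasis ℝ (TangentSpace (𝓡 3) x) i)) x •
    stdOrthonormalBasis ℝ (TangentSpace (𝓡 3) x) i

/-- The Riemann curvature `R(X, Y)Z = ∇_X ∇_Y Z - ∇_Y ∇_X Z - ∇_[X,Y] Z`. -/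
def riemannCurvature (X Y Z : (x : M) → TangentSpace (𝓡 3) x) (x : M) : TangentSpace (𝓡 3) x :=
  leviCivita X (leviCivita Y Z) x - leviCivita Y (leviCivita X Z) x
    - leviCivita (VectorField.mlieBracket (𝓡 3) X Y) Z x

/-- The scalar curvature `s_g(x) = ∑_{i,j} ⟨R(b_i, b_j) b_j, b_i⟩` for an orthonormal basis `b` of
the tangent space at `x`. (`R` is tensorial, so the vectors may be extended to vector fields
which are smooth near `x` in any way.) -/
def scalarCurvature (x : M) : ℝ :=
  ∑ i, ∑ j,
    let b := stdOrthonormalBasis ℝ (TangentSpace (𝓡 3) x)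
    inner ℝ
      (riemannCurvature (FiberBundle.extend E3 (b i)) (FiberBundle.extend E3 (b j))
        (FiberBundle.extend E3 (b j)) x) (b i)

end Riemannian

/-! ## `Spin^c` structures, spinors and gauge fields -/

section SpinC

variable {M : Type*} [TopologicalSpace M] [ChartedSpace E3 M] [IsManifold (𝓡 3) ∞ M]
  [Bundle.RiemannianBundle (fun x : M ↦ TangentSpace (𝓡 3) x)]

/-- A function with values in the Lie group `Spin^c(3)`, which sits in the finite-dimensional
vector space `ClC3`, is smooth iff it is smooth after applying every linear functional. -/
def SmoothIntoSpinC (h : M → SpinC3) (U : Set M) : Prop :=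
  ∀ l : ClC3 →ₗ[ℝ] ℝ, ContMDiffOn (𝓡 3) 𝓘(ℝ) ∞ (fun x ↦ l ((h x : ClC3ˣ) : ClC3)) U

/-- A `Spin^c` structure on the oriented Riemannian 3-manifold `M`: a smooth principal
`Spin^c(3)`-bundle `P` together with a smooth bundle map from `P` to the bundle of oriented
orthonormal frames which is equivariant with respect to `ξ₀ᶜ : Spin^c(3) → SO(3)`.
The bundle is given by its fibres `P x`, on which the group acts simply transitively from the
right, and its smooth structure by a family of local sections `sec i` over open sets `U i` covering
`M`, with smooth transition functions (the values of `sec i` outside `U i` are irrelevant). -/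
structure SpinCStructure (o : ManifoldOrientation M) where
  /-- The fibres of the principal bundle. -/
  P : M → Type*
  /-- The right action on the fibres. -/
  act {x : M} : P x → SpinC3 → P x
  act_one {x : M} (p : P x) : act p 1 = p
  act_mul {x : M} (p : P x) (g h : SpinC3) : act p (g * h) = act (act p g) h
  free {x : M} (p : P x) (g : SpinC3) : act p g = p → g = 1
  transitive {x : M} (p q : P x) : ∃ g, act p g = q
  /-- Index set of the family of local sections. -/
  ι : Type*
  /-- Domains of the local sections. -/
  U : ι → Set M
  isOpen_U (i : ι) : IsOpen (U i)
  cover (x : M) : ∃ i, x ∈ U i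
  /-- The local sections. -/
  sec (i : ι) (x : M) : P x
  /-- The transition functions. -/
  trans (i j : ι) (x : M) : SpinC3
  sec_eq (i j : ι) (x : M) : x ∈ U i → x ∈ U j → sec j x = act (sec i x) (trans i j x)
  smooth_trans (i j : ι) : SmoothIntoSpinC (trans i j) (U i ∩ U j)
  /-- The bundle map to the frame bundle: an orthonormal frame at `x` is seen as an isometry from
  `ℝ³` to the tangent space. -/
  frame {x : M} : P x → (E3 ≃ₗᵢ[ℝ] TangentSpace (𝓡 3) x)
  frame_oriented {x : M} (p : P x) :
    Orientation.map (Fin 3) (frame p).toLinearEquiv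
      (EuclideanSpace.basisFun (Fin 3) ℝ).toBasis.orientation = o.at_point x
  frame_act {x : M} (p : P x) (g : SpinC3) (v : E3) : frame (act p g) v = frame p (xi g v)
  smooth_frame (i : ι) (v : E3) :
    ContMDiffOn (𝓡 3) (𝓡 3).tangent ∞
      (fun x ↦ (⟨x, frame (sec i x) v⟩ : TangentBundle (𝓡 3) M)) (U i)

variable {o : ManifoldOrientation M}

namespace SpinCStructure

variable (S : SpinCStructure o)

/-- The `k`-th vector field of the local orthonormal frame `e = (e₁, e₂, e₃)` over `U i`. -/
def e (i : S.ι) (k : Fin 3) (x : M) : TangentSpace (𝓡 3) x := S.frame (S.sec i x) (stdVec k)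

/-- The connection forms of the Levi-Civita connection in the local frame,
`ω_{ab}(e_k) = ⟨∇_{e_k} e_a, e_b⟩`. -/
def omega (i : S.ι) (k a b : Fin 3) (x : M) : ℝ :=
  inner ℝ (leviCivita (S.e i k) (S.e i a) x) (S.e i b x)

/-- A spinor, i.e. a section of the spinor bundle `P ×_ρ ℂ²`, as an equivariant map `P → ℂ²`. -/
@[ext]
structure Spinor where
  /-- The equivariant map. -/
  val {x : M} : S.P x → Spin2
  equivariant {x : M} (p : S.P x) (g : SpinC3) :
    val (S.act p g) = matAct (spinRep (((g : ClC3ˣ)⁻¹ : ClC3ˣ) : ClC3)) (val p)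

/-- The transition functions `λ_{ij} = ζᶜ(h_{ij})` of the `U(1)`-bundle `P_{U(1)} = P ×_{ζᶜ} U(1)`
and of the canonical line bundle `L = P ×_{ζᶜ} ℂ`. -/
def lam (i j : S.ι) (x : M) : ℂ := zeta (S.trans i j x)

/-- A gauge field, i.e. a connection on `P_{U(1)}` or, equivalently, a Hermitian connection on the
canonical line bundle, given by its imaginary valued local connection 1-forms `A_i` with respect to
the local sections induced by `sec i`; they satisfy `A_j = A_i + λ_{ij}⁻¹ dλ_{ij}`. -/
@[ext]
structure GaugeField where
  /-- The local connection forms (their values outside `U i` are irrelevant). -/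
  form (i : S.ι) (x : M) : CCovector x
  imaginary (i : S.ι) (x : M) (v : TangentSpace (𝓡 3) x) : x ∈ S.U i → (form i x v).re = 0
  transition (i j : S.ι) (x : M) (v : TangentSpace (𝓡 3) x) : x ∈ S.U i → x ∈ S.U j →
    form j x v = form i x v + (S.lam i j x)⁻¹ * mvfderiv (𝓡 3) (S.lam i j) x v

variable {S}

/-- A spinor of class `C^n`. -/
def Spinor.IsC (n : ℕ∞ω) (ψ : S.Spinor) : Prop :=
  ∀ i, ContMDiffOn (𝓡 3) 𝓘(ℝ, Spin2) n (fun x ↦ ψ.val (S.sec i x)) (S.U i)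

/-- A gauge field of class `C^n`. -/
def GaugeField.IsC (n : ℕ∞ω) (A : S.GaugeField) : Prop :=
  ∀ i, ContMDiffOn (𝓡 3) ((𝓡 3).prod 𝓘(ℝ, E3 →L[ℝ] ℂ)) n
    (fun x ↦ Bundle.TotalSpace.mk' (E3 →L[ℝ] ℂ) (E := fun y : M ↦ CCovector y) x
      (A.form i x)) (S.U i)

/-- The supremum norm `‖ψ‖_∞` of a spinor: the pointwise norm at `x` is `‖ψ(p)‖` for any `p` in the
fibre over `x`. -/
def Spinor.supNorm (ψ : S.Spinor) : ℝ := ⨆ q : (x : M) × S.P x, ‖ψ.val q.2‖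

/-- The covariant derivative `∇^A_{e_k} ψ` in the local trivialization `sec i`:
`dψ(e_k) + ½ ∑_{a<b} ω_{ab}(e_k) c(e_a) c(e_b) ψ + ½ A_i(e_k) ψ`. -/
def covDeriv (A : S.GaugeField) (ψ : S.Spinor) (i : S.ι) (k : Fin 3) (x : M) : Spin2 :=
  mvfderiv (𝓡 3) (fun y ↦ ψ.val (S.sec i y)) x (S.e i k x)
    + (1 / 2 : ℂ) • (∑ a, ∑ b ∈ Finset.Ioi a, (S.omega i k a b x : ℂ) •
        matAct (cliffordMul (stdVec a)) (matAct (cliffordMul (stdVec b)) (ψ.val (S.sec i x))))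
    + (1 / 2 : ℂ) • (A.form i x (S.e i k x) • ψ.val (S.sec i x))

/-- The Dirac operator `D_A ψ = ∑_k c(e_k) ∇^A_{e_k} ψ` in the local trivialization `sec i`. -/
def dirac (A : S.GaugeField) (ψ : S.Spinor) (i : S.ι) (x : M) : Spin2 :=
  ∑ k, matAct (cliffordMul (stdVec k)) (covDeriv A ψ i k x)

/-- The components `F_A(e_k, e_l) = dA_i(e_k, e_l)` over `U i` of the curvature 2-form of `A`, with
`dα(X, Y) = X(α(Y)) - Y(α(X)) - α([X, Y])`. -/
def curvature (A : S.GaugeField) (i : S.ι) (k l : Fin 3) (x : M) : ℂ :=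
  mvfderiv (𝓡 3) (fun y ↦ A.form i y (S.e i l y)) x (S.e i k x)
    - mvfderiv (𝓡 3) (fun y ↦ A.form i y (S.e i k y)) x (S.e i l x)
    - A.form i x (VectorField.mlieBracket (𝓡 3) (S.e i k) (S.e i l) x)

/-- The components `(*F_A)(e_k)` of the Hodge star of the curvature 2-form in the oriented
orthonormal frame: `*(e² ∧ e³) = e¹` and cyclically (indices are added modulo 3). -/
def starCurvature (A : S.GaugeField) (i : S.ι) (k : Fin 3) (x : M) : ℂ :=
  curvature A i (k + 1) (k + 2) x

/-- The components `q(ψ)(e_k) = -½ ⟨c(e_k)ψ, ψ⟩` of the quadratic map, where the Hermitian metric is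
complex linear in the first entry (whereas `inner ℂ` is so in the second one). -/
def quadMap (φ : Spin2) (k : Fin 3) : ℂ :=
  -(1 / 2) * inner ℂ φ (matAct (cliffordMul (stdVec k)) φ)

/-- `(ψ, A)` is a Seiberg-Witten monopole: `D_A ψ = 0` and `*F_A = ½ q(ψ)`. -/
def IsMonopole (ψ : S.Spinor) (A : S.GaugeField) : Prop :=
  ∀ i, ∀ x ∈ S.U i, dirac A ψ i x = 0 ∧
    ∀ k, starCurvature A i k x = (1 / 2) * quadMap (ψ.val (S.sec i x)) k

/-- The group of gauge transformations `C^∞(M, U(1))`. -/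
abbrev GaugeGroup (M : Type*) [TopologicalSpace M] [ChartedSpace E3 M] : Type _ :=
  ContMDiffMap (𝓡 3) (𝓡 1) M Circle ∞

/-- A gauge transformation as a complex valued function. -/
def gaugeVal (γ : GaugeGroup M) (x : M) : ℂ := Circle.coeHom (γ x)

/-- The action of gauge transformations on spinors, `ψ ↦ γ⁻¹ ψ`. -/
def gaugeSpinor (γ : GaugeGroup M) (ψ : S.Spinor) : S.Spinor where
  val {x} p := (gaugeVal γ x)⁻¹ • ψ.val p
  equivariant p g := by rw [ψ.equivariant, map_smul]

lemma gauge_imaginary (γ : GaugeGroup M) (x : M) (v : TangentSpace (𝓡 3) x) :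
    ((gaugeVal γ x)⁻¹ * mvfderiv (𝓡 3) (gaugeVal γ) x v).re = 0 := by
  have hu : ∀ y, ‖gaugeVal γ y‖ = 1 := fun y => Circle.norm_coe (γ y)
  by_cases hγ : MDifferentiableAt (𝓡 3) 𝓘(ℝ, ℂ) (gaugeVal γ) x
  · have h1 := hγ.hasMFDerivAt
    have h2 : HasMFDerivAt 𝓘(ℝ, ℂ) 𝓘(ℝ, ℝ) (fun z : ℂ ↦ ‖z‖ ^ 2) (gaugeVal γ x)
        (2 • innerSL ℝ (gaugeVal γ x)) := (hasStrictFDerivAt_norm_sq _).hasFDerivAt.hasMFDerivAt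
    have h3 := HasMFDerivAt.comp x h2 h1
    have h4 : ((fun z : ℂ ↦ ‖z‖ ^ 2) ∘ gaugeVal γ) = fun _ ↦ (1 : ℝ) := by
      funext y
      simp [hu]
    rw [h4] at h3
    have h5 := hasMFDerivAt_unique h3 (hasMFDerivAt_const (1 : ℝ) x)
    have h6 : inner ℝ (gaugeVal γ x) (mvfderiv (𝓡 3) (gaugeVal γ) x v) = 0 := by
      have h7 := congrArg (fun L => L v) h5
      have h8 : (2 : ℝ) * inner ℝ (gaugeVal γ x) (mvfderiv (𝓡 3) (gaugeVal γ) x v) = 0 := by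
        rw [two_mul, ← two_nsmul]
        exact h7
      linarith
    have h9 : (gaugeVal γ x)⁻¹ = (starRingEnd ℂ) (gaugeVal γ x) :=
      Complex.inv_eq_conj (hu x)
    rw [h9]
    rw [Complex.inner] at h6
    simpa [mul_comm] using h6
  · have : mvfderiv (𝓡 3) (gaugeVal γ) x = 0 := by
      unfold mvfderiv
      rw [mfderiv_zero_of_not_mdifferentiableAt hγ]
      simp
    simp [this]

/-- The action of gauge transformations on gauge fields, `A ↦ A + 2 γ⁻¹ dγ`. -/
def gaugeGaugeField (γ : GaugeGroup M) (A : S.GaugeField) : S.GaugeField where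
  form i x := A.form i x + (2 * (gaugeVal γ x)⁻¹) • mvfderiv (𝓡 3) (gaugeVal γ) x
  imaginary i x v hx := by
    have h := gauge_imaginary γ x v
    have h' := A.imaginary i x v hx
    have h2 : ∀ w z : ℂ, (2 * w * z).re = 2 * (w * z).re := fun w z => by
      rw [mul_assoc]; simp
    rw [add_apply, smul_apply, smul_eq_mul, Complex.add_re, h2, h, h']
    simp
  transition i j x v hi hj := by
    have h := A.transition i j x v hi hj
    simp only [add_apply, h]
    ring

/-- `(ψ, A)` is reducible: its stabilizer in the group of gauge transformations is not trivial. -/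
def IsReducible (ψ : S.Spinor) (A : S.GaugeField) : Prop :=
  ∃ γ : GaugeGroup M, γ ≠ 1 ∧ gaugeSpinor γ ψ = ψ ∧ gaugeGaugeField γ A = A

end SpinCStructure

end SpinC

end SeibergWitten

end

noncomputable section

namespace SeibergWitten

open VectorField Filter Topology

/-! The bound is a maximum principle for `|ψ|²`. The Weitzenböck formula for a harmonic spinor,
paired with `ψ`, says that `Re ⟨tr ∇²ψ, ψ⟩ = s/4 |ψ|² + ½ ⟨c(F_A)ψ, ψ⟩`. The curvature equation
turns the last term into `|ψ|⁴/8`, because the three numbers `⟨σ_m ψ, ψ⟩` have sum of squares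
`|ψ|⁴`. Where `|ψ|²` is maximal, its first derivatives vanish and its second derivatives are
nonpositive, so the left side is at most `-|∇ψ|² ≤ 0`. Hence `s/4 |ψ|² + |ψ|⁴/8 ≤ 0` there
(`monopole_estimate`): either `ψ` vanishes at the maximum, hence everywhere, or `|ψ|² ≤ -2s` at that
point.

The computation is made at one point in an arbitrary smooth orthonormal frame, not a geodesic one.
The connection coefficients, their derivatives and the first and second frame derivatives of `ψ`
become plain numbers and vectors subject to linear relations. With these, `weitzenboeck` and
`curvature_estimate` are linear algebra over a Clifford module. Pairing with `ψ` leaves only the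
trace of the curvature, so no Bianchi identity is needed.

The analytic input is `mvfderiv_comm` (brackets as commutators),
`mvfderiv_mvfderiv_nonpos_of_isLocalMax`, and `scalarCurvature_eq`, which expresses the pointwise
definition of `s` through the connection coefficients of the frame. Unitarity of the spin
representation makes `|ψ|` a function on `M`, and compactness supplies its maximum. If `s ≥ 0`, the
bound forces `ψ = 0`, and then the constant gauge transformation `-1` fixes the pair. -/

/-- The second-order necessary condition at a local maximum. -/
lemma fderiv_fderiv_nonpos_of_isLocalMax {E : Type*} [NormedAddCommGroup E] [NormedSpace ℝ E]
    {g : E → ℝ} {u : E} (hg : ContDiffAt ℝ 2 g u) (hmax : IsLocalMax g u) (v : E) :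
    fderiv ℝ (fderiv ℝ g) u v v ≤ 0 := by
  set l : ℝ → E := fun t ↦ u + t • v
  have hl0 : l 0 = u := by simp [l]
  have hl (t : ℝ) : HasDerivAt l v t := by
    have h := ((hasDerivAt_id t).smul_const v).const_add u
    rwa [one_smul] at h
  have hlc : Tendsto l (𝓝 0) (𝓝 u) := hl0 ▸ (hl 0).continuousAt.tendsto
  have hd : ∀ᶠ t in 𝓝 (0 : ℝ), HasDerivAt (g ∘ l) (fderiv ℝ g (l t) v) t := by
    have h1 := (hg.eventually (by simp)).filter_mono le_rfl
    filter_upwards [hlc.eventually h1] with t ht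
    exact (ht.differentiableAt (by norm_num)).hasFDerivAt.comp_hasDerivAt t (hl t)
  have hderiv : deriv (g ∘ l) =ᶠ[𝓝 0] fun t ↦ fderiv ℝ g (l t) v := by
    filter_upwards [hd] with t ht using ht.deriv
  have hg' : DifferentiableAt ℝ (fderiv ℝ g) (l 0) := by
    rw [hl0]
    exact (hg.fderiv_right (m := 1) (by norm_num)).differentiableAt (by norm_num)
  have hdd : deriv (deriv (g ∘ l)) 0 = fderiv ℝ (fderiv ℝ g) u v v := by
    rw [hderiv.deriv_eq]
    have := (hg'.hasFDerivAt.comp_hasDerivAt 0 (hl 0)).clm_apply (hasDerivAt_const (0 : ℝ) v)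
    rw [HasDerivAt.deriv (f' := fderiv ℝ (fderiv ℝ g) u v v) (by simpa [hl0] using this)]
  have hlmax : IsLocalMax (g ∘ l) 0 := by
    have := hlc.eventually hmax
    simpa [IsLocalMax, IsMaxFilter, hl0] using this
  -- A positive second derivative would make the critical point `0` a local minimum as well, so `g ∘
  -- l` would be locally constant and its second derivative zero.
  by_contra! hpos
  rw [← hdd] at hpos
  have hmin := isLocalMin_of_deriv_deriv_pos hpos hlmax.deriv_eq_zero hd.self_of_nhds.continuousAt
  have hconst : (g ∘ l) =ᶠ[𝓝 0] fun _ ↦ (g ∘ l) 0 := by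
    filter_upwards [hmin, hlmax] with t h1 h2 using le_antisymm h2 h1
  have : deriv (deriv (g ∘ l)) 0 = 0 := by
    rw [hconst.deriv.deriv_eq]
    simp
  linarith

/-! ### Directional derivatives and Lie brackets in charts -/

section ChartCalculus

variable {E : Type*} [NormedAddCommGroup E] [NormedSpace ℝ E]
  {H : Type*} [TopologicalSpace H] {I : ModelWithCorners ℝ E H}
  {M : Type*} [TopologicalSpace M] [ChartedSpace H M]
  {F : Type*} [NormedAddCommGroup F] [NormedSpace ℝ F]

lemma mvfderiv_eq_of_hasMFDerivAt {f : M → F} {x : M} {f' : TangentSpace I x →L[ℝ] F}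
    (h : HasMFDerivAt I 𝓘(ℝ, F) f x f') (v : TangentSpace I x) : mvfderiv I f x v = f' v := by
  have := congrArg (fun L : E →L[ℝ] F => L v) h.mfderiv
  exact this

lemma mvfderiv_congr {f g : M → F} {x : M} (h : f =ᶠ[𝓝 x] g) (v : TangentSpace I x) :
    mvfderiv I f x v = mvfderiv I g x v := by
  have := congrArg (fun L : E →L[ℝ] F => L v) (h.mfderiv_eq (I := I) (I' := 𝓘(ℝ, F)))
  exact this

/-- `f` is differentiable at `x` with derivative `f'` in the direction `v`. -/
def HasDirDeriv (f : M → F) (x : M) (v : TangentSpace I x) (f' : F) : Prop :=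
  MDifferentiableAt I 𝓘(ℝ, F) f x ∧ mvfderiv I f x v = f'

namespace HasDirDeriv

variable {f g : M → F} {x : M} {v : TangentSpace I x} {f' g' : F}

lemma _root_.MDifferentiableAt.hasDirDeriv (hf : MDifferentiableAt I 𝓘(ℝ, F) f x)
    (v : TangentSpace I x) : HasDirDeriv f x v (mvfderiv I f x v) := ⟨hf, rfl⟩

lemma const (c : F) (v : TangentSpace I x) : HasDirDeriv (fun _ : M ↦ c) x v 0 :=
  ⟨mdifferentiableAt_const, by rw [mvfderiv_const]; rfl⟩

lemma add (hf : HasDirDeriv f x v f') (hg : HasDirDeriv g x v g') :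
    HasDirDeriv (fun y ↦ f y + g y) x v (f' + g') :=
  ⟨hf.1.add hg.1, by rw [mvfderiv_fun_add hf.1 hg.1, add_apply, hf.2, hg.2]⟩

lemma smul {a : M → ℝ} {a' : ℝ} (ha : HasDirDeriv a x v a') (hf : HasDirDeriv f x v f') :
    HasDirDeriv (fun y ↦ a y • f y) x v (a' • f x + a x • f') :=
  ⟨ha.1.smul hf.1, by
    rw [mvfderiv_fun_smul ha.1 hf.1, add_apply, smul_apply, hf.2, ContinuousLinearMap.smulRight_apply,
      ha.2, add_comm]⟩

lemma mul {a b : M → ℝ} {a' b' : ℝ} (ha : HasDirDeriv a x v a') (hb : HasDirDeriv b x v b') :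
    HasDirDeriv (fun y ↦ a y * b y) x v (a' * b x + a x * b') :=
  ha.smul hb

lemma sum {ι : Type*} {s : Finset ι} {f : ι → M → F} {f' : ι → F}
    (hf : ∀ i ∈ s, HasDirDeriv (f i) x v (f' i)) :
    HasDirDeriv (fun y ↦ ∑ i ∈ s, f i y) x v (∑ i ∈ s, f' i) := by
  classical
  induction s using Finset.induction_on with
  | empty => simpa using const (0 : F) v
  | insert a s ha ih =>
    simp only [Finset.sum_insert ha]
    exact (hf a (by simp)).add (ih fun i hi ↦ hf i (by simp [hi]))

lemma clm_apply {G : Type*} [NormedAddCommGroup G] [NormedSpace ℝ G] (L : F →L[ℝ] G)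
    (hf : HasDirDeriv f x v f') : HasDirDeriv (fun y ↦ L (f y)) x v (L f') := by
  have h := (L.hasFDerivAt (x := f x)).hasMFDerivAt.comp x hf.1.hasMFDerivAt
  refine ⟨h.mdifferentiableAt, ?_⟩
  rw [← hf.2]
  exact mvfderiv_eq_of_hasMFDerivAt h v

lemma congr_of_eventuallyEq (hf : HasDirDeriv f x v f') (h : g =ᶠ[𝓝 x] f) :
    HasDirDeriv g x v f' :=
  ⟨hf.1.congr_of_eventuallyEq h, (mvfderiv_congr h v).trans hf.2⟩

end HasDirDeriv

variable [I.Boundaryless]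

/-- The representation of a vector field in the chart at `x`. -/
def chartField (x : M) (Y : (y : M) → TangentSpace I y) : E → E :=
  mpullbackWithin 𝓘(ℝ, E) I (extChartAt I x).symm Y (Set.range I)

/-- The derivative of a function, computed in a chart. -/
lemma mvfderiv_eq_fderiv_chart [IsManifold I 1 M] {f : M → F} {x y : M}
    (hy : y ∈ (extChartAt I x).source)
    (hf : MDifferentiableAt I 𝓘(ℝ, F) f y) (v : TangentSpace I y) :
    mvfderiv I f y v = fderiv ℝ (f ∘ (extChartAt I x).symm) (extChartAt I x y)
      (mfderiv I 𝓘(ℝ, E) (extChartAt I x) y v) := by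
  have hleft : (extChartAt I x).symm (extChartAt I x y) = y := (extChartAt I x).left_inv hy
  have hev : f =ᶠ[𝓝 y] (f ∘ (extChartAt I x).symm) ∘ extChartAt I x := by
    filter_upwards [(isOpen_extChartAt_source x).mem_nhds hy] with z hz
    simp only [Function.comp_apply, (extChartAt I x).left_inv hz]
  have hsymm : MDifferentiableAt 𝓘(ℝ, E) I (extChartAt I x).symm (extChartAt I x y) := by
    have := mdifferentiableWithinAt_extChartAt_symm (I := I) ((extChartAt I x).map_source hy)
    rwa [I.range_eq_univ, mdifferentiableWithinAt_univ] at this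
  have hg : MDifferentiableAt 𝓘(ℝ, E) 𝓘(ℝ, F) (f ∘ (extChartAt I x).symm) (extChartAt I x y) :=
    MDifferentiableAt.comp (I' := I) _ (by rwa [hleft]) hsymm
  have hφ : MDifferentiableAt I 𝓘(ℝ, E) (extChartAt I x) y :=
    mdifferentiableAt_extChartAt (by rwa [← extChartAt_source I])
  rw [mvfderiv_congr hev]
  have h := (hg.differentiableAt.hasFDerivAt.hasMFDerivAt).comp y hφ.hasMFDerivAt
  exact mvfderiv_eq_of_hasMFDerivAt h v

/-- The chart is fixed at `x` while `y` varies near `x`, so that derivatives along `Y` can be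
differentiated once more. -/
lemma mfderiv_extChartAt_eq_chartField [CompleteSpace E] [IsManifold I 1 M] (x : M)
    (Y : (y : M) → TangentSpace I y) :
    ∀ᶠ y in 𝓝 x, mfderiv I 𝓘(ℝ, E) (extChartAt I x) y (Y y) =
      chartField (E := E) x Y (extChartAt I x y) := by
  have h := eventuallyEq_mpullback_mpullbackWithin_extChartAt (I := I) (s := Set.univ) (x := x) Y
  rw [nhdsWithin_univ] at h
  filter_upwards [h, extChartAt_source_mem_nhds (I := I) x] with y hy hys
  rw [hy, mpullback_apply]
  exact (isInvertible_mfderiv_extChartAt (I := I) hys).self_apply_inverse _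

variable [CompleteSpace E] [IsManifold I ∞ M]

lemma differentiableAt_chartField {x : M} {Y : (y : M) → TangentSpace I y}
    (hY : MDifferentiableAt I I.tangent (fun y ↦ (⟨y, Y y⟩ : TangentBundle I M)) x) :
    DifferentiableAt ℝ (chartField x Y) (extChartAt I x x) := by
  have := (mdifferentiableWithinAt_univ.2 hY).differentiableWithinAt_mpullbackWithin_vectorField
  have hu : (extChartAt I x).symm ⁻¹' Set.univ ∩ Set.range I = Set.univ := by
    rw [I.range_eq_univ, Set.preimage_univ, Set.univ_inter]
  exact differentiableWithinAt_univ.1 (hu ▸ this)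

/-- The manifold bracket is by definition the pullback of the bracket of the chart fields; the
differential of the chart undoes that pullback. -/
lemma mvfderiv_mlieBracket {f : M → F} {x : M} (hf : MDifferentiableAt I 𝓘(ℝ, F) f x)
    (X Y : (y : M) → TangentSpace I y) :
    mvfderiv I f x (mlieBracket I X Y x) =
      fderiv ℝ (f ∘ (extChartAt I x).symm) (extChartAt I x x)
        (lieBracket ℝ (chartField x X) (chartField x Y) (extChartAt I x x)) := by
  rw [mvfderiv_eq_fderiv_chart (mem_extChartAt_source x) hf, ← mlieBracketWithin_univ,
    mlieBracketWithin_apply]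
  congr 1
  refine ((isInvertible_mfderiv_extChartAt (mem_extChartAt_source x)).self_apply_inverse _).trans ?_
  have hu : (extChartAt I x).symm ⁻¹' Set.univ ∩ Set.range I = Set.univ := by
    rw [I.range_eq_univ, Set.preimage_univ, Set.univ_inter]
  rw [hu]
  exact congrFun (lieBracketWithin_univ (𝕜 := ℝ) (V := chartField x X) (W := chartField x Y)) _

/-- The second derivative of a function along two vector fields, computed in a chart. -/
lemma mvfderiv_mvfderiv_eq {f : M → F} {x : M} (hf : ContMDiffAt I 𝓘(ℝ, F) 2 f x)
    (X : (y : M) → TangentSpace I y) {Y : (y : M) → TangentSpace I y}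
    (hY : MDifferentiableAt I I.tangent (fun y ↦ (⟨y, Y y⟩ : TangentBundle I M)) x) :
    MDifferentiableAt I 𝓘(ℝ, F) (fun y ↦ mvfderiv I f y (Y y)) x ∧
    mvfderiv I (fun y ↦ mvfderiv I f y (Y y)) x (X x) =
      fderiv ℝ (fderiv ℝ (f ∘ (extChartAt I x).symm)) (extChartAt I x x)
        (chartField x X (extChartAt I x x)) (chartField x Y (extChartAt I x x)) +
      fderiv ℝ (f ∘ (extChartAt I x).symm) (extChartAt I x x)
        (fderiv ℝ (chartField x Y) (extChartAt I x x) (chartField x X (extChartAt I x x))) := by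
  set φ := extChartAt I x
  set g := f ∘ φ.symm
  have hx : x ∈ φ.source := mem_extChartAt_source x
  have hg : ContDiffAt ℝ 2 g (φ x) := by
    have := (contMDiffAt_iff (x := x)).1 hf
    have h2 := this.2
    rw [I.range_eq_univ, contDiffWithinAt_univ] at h2
    exact h2
  have hg' : DifferentiableAt ℝ (fderiv ℝ g) (φ x) :=
    (hg.fderiv_right (m := 1) (by norm_num)).differentiableAt (by norm_num)
  have hYd : DifferentiableAt ℝ (chartField x Y) (φ x) := differentiableAt_chartField hY
  -- The chart formula for the first derivative holds on a neighbourhood, since being `C²` is an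
  -- open condition; hence it may be differentiated at `x`.
  have hev : (fun y ↦ mvfderiv I f y (Y y)) =ᶠ[𝓝 x]
      (fun u ↦ fderiv ℝ g u (chartField x Y u)) ∘ φ := by
    have h1 := (contMDiffAt_iff_contMDiffAt_nhds (n := 2) (by simp)).1 hf
    filter_upwards [h1, extChartAt_source_mem_nhds (I := I) x,
      mfderiv_extChartAt_eq_chartField x Y] with y hy hys hYy
    rw [mvfderiv_eq_fderiv_chart hys (hy.mdifferentiableAt (by norm_num)), hYy]
    rfl
  have hφ : MDifferentiableAt I 𝓘(ℝ, E) φ x :=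
    mdifferentiableAt_extChartAt (mem_chart_source H x)
  have hd := hg'.hasFDerivAt.clm_apply hYd.hasFDerivAt
  have hcomp := (hd.hasMFDerivAt).comp x hφ.hasMFDerivAt
  refine ⟨hcomp.mdifferentiableAt.congr_of_eventuallyEq hev, ?_⟩
  rw [mvfderiv_congr hev, mvfderiv_eq_of_hasMFDerivAt hcomp]
  have hX := (mfderiv_extChartAt_eq_chartField x X).self_of_nhds
  rw [add_comm]
  rw [← hX]
  rfl

/-- The Lie bracket as a commutator of derivations. -/
lemma mvfderiv_comm {f : M → F} {x : M} (hf : ContMDiffAt I 𝓘(ℝ, F) 2 f x)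
    {X Y : (y : M) → TangentSpace I y}
    (hX : MDifferentiableAt I I.tangent (fun y ↦ (⟨y, X y⟩ : TangentBundle I M)) x)
    (hY : MDifferentiableAt I I.tangent (fun y ↦ (⟨y, Y y⟩ : TangentBundle I M)) x) :
    mvfderiv I (fun y ↦ mvfderiv I f y (Y y)) x (X x) -
      mvfderiv I (fun y ↦ mvfderiv I f y (X y)) x (Y x) =
      mvfderiv I f x (mlieBracket I X Y x) := by
  have hg : ContDiffAt ℝ 2 (f ∘ (extChartAt I x).symm) (extChartAt I x x) := by
    have h2 := ((contMDiffAt_iff (x := x)).1 hf).2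
    rw [I.range_eq_univ, contDiffWithinAt_univ] at h2
    exact h2
  -- The second-derivative terms cancel by symmetry; the derivatives of the two chart fields that
  -- remain form the bracket.
  have hsymm := hg.isSymmSndFDerivAt (by simp)
  rw [(mvfderiv_mvfderiv_eq hf X hY).2, (mvfderiv_mvfderiv_eq hf Y hX).2,
    mvfderiv_mlieBracket (hf.mdifferentiableAt (by norm_num)), lieBracket, map_sub,
    hsymm.eq]
  abel

lemma _root_.IsLocalMax.comp_extChartAt_symm {f : M → ℝ} {x : M} (hmax : IsLocalMax f x) :
    IsLocalMax (f ∘ (extChartAt I x).symm) (extChartAt I x x) := by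
  have := (continuousAt_extChartAt_symm (I := I) x).tendsto.eventually
    (p := fun y => f y ≤ f x) (by simpa [IsLocalMax, IsMaxFilter] using hmax)
  simpa [IsLocalMax, IsMaxFilter] using this

lemma mvfderiv_eq_zero_of_isLocalMax {f : M → ℝ} {x : M} (hf : MDifferentiableAt I 𝓘(ℝ) f x)
    (hmax : IsLocalMax f x) (v : TangentSpace I x) : mvfderiv I f x v = 0 := by
  have hmax' := hmax.comp_extChartAt_symm (I := I)
  rw [mvfderiv_eq_fderiv_chart (mem_extChartAt_source x) hf, hmax'.fderiv_eq_zero]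
  rfl

/-- The second derivative of a function along a vector field is nonpositive at a local maximum. -/
lemma mvfderiv_mvfderiv_nonpos_of_isLocalMax {f : M → ℝ} {x : M} (hf : ContMDiffAt I 𝓘(ℝ) 2 f x)
    (hmax : IsLocalMax f x) {X : (y : M) → TangentSpace I y}
    (hX : MDifferentiableAt I I.tangent (fun y ↦ (⟨y, X y⟩ : TangentBundle I M)) x) :
    mvfderiv I (fun y ↦ mvfderiv I f y (X y)) x (X x) ≤ 0 := by
  have hg : ContDiffAt ℝ 2 (f ∘ (extChartAt I x).symm) (extChartAt I x x) := by
    have h2 := ((contMDiffAt_iff (x := x)).1 hf).2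
    rw [I.range_eq_univ, contDiffWithinAt_univ] at h2
    exact h2
  have hmax' := hmax.comp_extChartAt_symm (I := I)
  -- The term containing the derivative of `X` is multiplied by the differential of `f`, which
  -- vanishes at a maximum, so only the Hessian survives.
  rw [(mvfderiv_mvfderiv_eq hf X hX).2, hmax'.fderiv_eq_zero, zero_apply, add_zero]
  exact fderiv_fderiv_nonpos_of_isLocalMax hg hmax' _

end ChartCalculus

/-- A vector field is differentiable at a point. -/
abbrev FieldDiffAt {M : Type*} [TopologicalSpace M] [ChartedSpace E3 M] [IsManifold (𝓡 3) ∞ M]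
    (X : (x : M) → TangentSpace (𝓡 3) x) (x : M) : Prop :=
  MDifferentiableAt (𝓡 3) (𝓡 3).tangent (fun y ↦ (⟨y, X y⟩ : TangentBundle (𝓡 3) M)) x

/-! ### The Levi-Civita connection from the Koszul formula -/

section LeviCivita

variable {M : Type*} [TopologicalSpace M] [ChartedSpace E3 M] [IsManifold (𝓡 3) ∞ M]
  [Bundle.RiemannianBundle (fun x : M ↦ TangentSpace (𝓡 3) x)]
  [IsContMDiffRiemannianBundle (𝓡 3) ∞ E3 (fun x : M ↦ TangentSpace (𝓡 3) x)]

variable {X Y Z : (x : M) → TangentSpace (𝓡 3) x} {x : M}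

lemma FieldDiffAt.inner (hX : FieldDiffAt X x) (hY : FieldDiffAt Y x) :
    MDifferentiableAt (𝓡 3) 𝓘(ℝ) (fun y ↦ inner ℝ (X y) (Y y)) x :=
  haveI : IsContMDiffRiemannianBundle (𝓡 3) 1 E3 (fun x : M ↦ TangentSpace (𝓡 3) x) :=
    IsContMDiffRiemannianBundle.of_le (n := ∞) (by simp)
  MDifferentiableAt.inner_bundle hX hY

/-- The derivatives of a factor `f` produced by the product rule cancel against those from the
brackets. This frees the definition of `leviCivita` from its choice of extensions. -/
lemma koszul_tensorial_right (hX : FieldDiffAt X x) (hY : FieldDiffAt Y x) :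
    TensorialAt (𝓡 3) E3 (fun Z : (x : M) → TangentSpace (𝓡 3) x ↦ koszul X Y Z x) x where
  smul {f Z} hf hZ := by
    simp [koszul, inner_smul_left, inner_smul_right,
      mvfderiv_fun_mul hf (FieldDiffAt.inner hY hZ),
      mvfderiv_fun_mul hf (FieldDiffAt.inner hX hZ),
      mlieBracket_smul_right hf hZ, inner_add_left]
    rw [real_inner_comm (Z x) (Y x), real_inner_comm (Z x) (X x)]
    ring
  add {Z Z'} hZ hZ' := by
    simp [koszul, inner_add_right, mvfderiv_fun_add (FieldDiffAt.inner hY hZ) (FieldDiffAt.inner hY hZ'),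
      mvfderiv_fun_add (FieldDiffAt.inner hX hZ) (FieldDiffAt.inner hX hZ'),
      mlieBracket_add_right hZ hZ', inner_add_left]
    ring

/-- Makes `∇_X e_b` expandable in the connection coefficients by expanding `X` in the frame. -/
lemma koszul_tensorial_left (hY : FieldDiffAt Y x) (hZ : FieldDiffAt Z x) :
    TensorialAt (𝓡 3) E3 (fun X : (x : M) → TangentSpace (𝓡 3) x ↦ koszul X Y Z x) x where
  smul {f X} hf hX := by
    simp [koszul, inner_smul_left, inner_smul_right,
      mvfderiv_fun_mul hf (FieldDiffAt.inner hX hY),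
      mvfderiv_fun_mul hf (FieldDiffAt.inner hX hZ),
      mlieBracket_smul_left hf hX, inner_add_left]
    ring
  add {X X'} hX hX' := by
    simp [koszul, inner_add_right, mvfderiv_fun_add (FieldDiffAt.inner hX hY) (FieldDiffAt.inner hX' hY),
      mvfderiv_fun_add (FieldDiffAt.inner hX hZ) (FieldDiffAt.inner hX' hZ),
      mlieBracket_add_left hX hX', inner_add_left]
    ring

/-- The Levi-Civita connection satisfies the Koszul formula. -/
lemma inner_leviCivita (hX : FieldDiffAt X x) (hY : FieldDiffAt Y x) (hZ : FieldDiffAt Z x) :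
    inner ℝ (leviCivita X Y x) (Z x) = koszul X Y Z x := by
  have ht := koszul_tensorial_right hX hY
  set b := stdOrthonormalBasis ℝ (TangentSpace (𝓡 3) x)
  rw [← TensorialAt.mkHom_apply ht hZ]
  conv_rhs => rw [← b.sum_repr (Z x)]
  rw [map_sum, leviCivita, sum_inner]
  refine Finset.sum_congr rfl fun i _ ↦ ?_
  rw [map_smul, TensorialAt.mkHom_apply_eq_extend, inner_smul_left, b.repr_apply_apply, smul_eq_mul,
    mul_comm]
  rfl

/-- The Levi-Civita connection is metric. -/
lemma mvfderiv_inner (hX : FieldDiffAt X x) (hY : FieldDiffAt Y x) (hZ : FieldDiffAt Z x) :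
    mvfderiv (𝓡 3) (fun y ↦ inner ℝ (Y y) (Z y)) x (X x) =
      inner ℝ (leviCivita X Y x) (Z x) + inner ℝ (Y x) (leviCivita X Z x) := by
  rw [inner_leviCivita hX hY hZ, real_inner_comm, inner_leviCivita hX hZ hY, koszul, koszul,
    mlieBracket_swap_apply (V := Z) (W := Y), inner_neg_left]
  simp only [real_inner_comm]
  ring

/-- The Levi-Civita connection is torsion-free. -/
lemma inner_mlieBracket (hX : FieldDiffAt X x) (hY : FieldDiffAt Y x) (hZ : FieldDiffAt Z x) :
    inner ℝ (mlieBracket (𝓡 3) X Y x) (Z x) =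
      inner ℝ (leviCivita X Y x) (Z x) - inner ℝ (leviCivita Y X x) (Z x) := by
  rw [inner_leviCivita hX hY hZ, inner_leviCivita hY hX hZ, koszul, koszul,
    mlieBracket_swap_apply (V := Y) (W := X), inner_neg_left]
  have : (fun y ↦ inner ℝ (Y y) (X y)) = (fun y ↦ inner ℝ (X y) (Y y)) := by
    funext y; exact real_inner_comm _ _
  rw [this]
  ring

end LeviCivita

/-! ### Connection coefficients of an orthonormal frame -/

section OrthoFrame

variable {M : Type*} [TopologicalSpace M] [ChartedSpace E3 M] [IsManifold (𝓡 3) ∞ M]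

lemma contMDiffAt_mlieBracket {X Y : (x : M) → TangentSpace (𝓡 3) x} {x : M}
    (hX : ContMDiffAt (𝓡 3) (𝓡 3).tangent ∞ (fun y ↦ (⟨y, X y⟩ : TangentBundle (𝓡 3) M)) x)
    (hY : ContMDiffAt (𝓡 3) (𝓡 3).tangent ∞ (fun y ↦ (⟨y, Y y⟩ : TangentBundle (𝓡 3) M)) x) :
    ContMDiffAt (𝓡 3) (𝓡 3).tangent ∞
      (fun y ↦ (⟨y, mlieBracket (𝓡 3) X Y y⟩ : TangentBundle (𝓡 3) M)) x :=
  haveI : IsManifold (𝓡 3) (((⊤ : ℕ∞) : WithTop ℕ∞) + 1) M := by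
    simpa using ‹IsManifold (𝓡 3) ∞ M›
  haveI : IsManifold (𝓡 3) (minSmoothness ℝ 2) M := by
    rw [minSmoothness_of_isRCLikeNormedField]; infer_instance
  haveI : IsManifold (𝓡 3) (minSmoothness ℝ 3) M := by
    rw [minSmoothness_of_isRCLikeNormedField]; infer_instance
  ContMDiffAt.mlieBracket_vectorField (m := ⊤) (n := ⊤) hX hY (by simp)

variable [Bundle.RiemannianBundle (fun x : M ↦ TangentSpace (𝓡 3) x)]

/-- A smooth orthonormal frame over an open set. -/
structure IsOrthoFrameOn (e : Fin 3 → (x : M) → TangentSpace (𝓡 3) x) (U : Set M) : Prop where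
  isOpen : IsOpen U
  smooth (k : Fin 3) : ContMDiffOn (𝓡 3) (𝓡 3).tangent ∞
    (fun y ↦ (⟨y, e k y⟩ : TangentBundle (𝓡 3) M)) U
  orthonormal {x : M} (hx : x ∈ U) : Orthonormal ℝ (fun k ↦ e k x)

/-- The connection coefficients `⟨∇_{e_k} e_a, e_b⟩` of a frame. -/
def connForm (e : Fin 3 → (x : M) → TangentSpace (𝓡 3) x) (k a b : Fin 3) (x : M) : ℝ :=
  inner ℝ (leviCivita (e k) (e a) x) (e b x)

/-- The curvature coefficients `⟨R(e_l, e_k) e_a, e_b⟩` in terms of the connection coefficients. -/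
def curvCoeff (e : Fin 3 → (x : M) → TangentSpace (𝓡 3) x) (l k a b : Fin 3) (x : M) : ℝ :=
  mvfderiv (𝓡 3) (connForm e k a b) x (e l x) - mvfderiv (𝓡 3) (connForm e l a b) x (e k x)
    + ∑ c, (connForm e k a c x * connForm e l c b x - connForm e l a c x * connForm e k c b x)
    - ∑ m, (connForm e l k m x - connForm e k l m x) * connForm e m a b x

namespace IsOrthoFrameOn

variable {e : Fin 3 → (x : M) → TangentSpace (𝓡 3) x} {U : Set M} {x : M}

/-- The orthonormal basis given by an orthonormal frame at a point. -/
def basisAt (h : IsOrthoFrameOn e U) (hx : x ∈ U) :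
    OrthonormalBasis (Fin 3) ℝ (TangentSpace (𝓡 3) x) :=
  OrthonormalBasis.mk (h.orthonormal hx) (by
    have hr : Module.finrank ℝ (TangentSpace (𝓡 3) x) = 3 :=
      (finrank_euclideanSpace_fin : Module.finrank ℝ E3 = 3)
    exact ((h.orthonormal hx).linearIndependent.span_eq_top_of_card_eq_finrank
      (by rw [hr, Fintype.card_fin])).ge)

lemma basisAt_apply (h : IsOrthoFrameOn e U) (hx : x ∈ U) (k : Fin 3) :
    h.basisAt hx k = e k x := by
  simp [basisAt]

lemma eq_sum (h : IsOrthoFrameOn e U) (hx : x ∈ U) (v : TangentSpace (𝓡 3) x) :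
    v = ∑ k, inner ℝ v (e k x) • e k x := by
  conv_lhs => rw [← (h.basisAt hx).sum_repr v]
  simp only [OrthonormalBasis.repr_apply_apply, h.basisAt_apply hx, real_inner_comm]

lemma contMDiffAt (h : IsOrthoFrameOn e U) (hx : x ∈ U) (k : Fin 3) :
    ContMDiffAt (𝓡 3) (𝓡 3).tangent ∞ (fun y ↦ (⟨y, e k y⟩ : TangentBundle (𝓡 3) M)) x :=
  (h.smooth k).contMDiffAt (h.isOpen.mem_nhds hx)

lemma fieldDiffAt (h : IsOrthoFrameOn e U) (hx : x ∈ U) (k : Fin 3) : FieldDiffAt (e k) x :=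
  (h.contMDiffAt hx k).mdifferentiableAt (by simp)

lemma inner_eq (h : IsOrthoFrameOn e U) (hx : x ∈ U) (a b : Fin 3) :
    inner ℝ (e a x) (e b x) = if a = b then 1 else 0 :=
  orthonormal_iff_ite.1 (h.orthonormal hx) a b

/-- The differential of a function in terms of an orthonormal frame. -/
lemma mvfderiv_eq_sum (h : IsOrthoFrameOn e U) (hx : x ∈ U) {F : Type*} [NormedAddCommGroup F]
    [NormedSpace ℝ F] (f : M → F) (v : TangentSpace (𝓡 3) x) :
    mvfderiv (𝓡 3) f x v = ∑ l, inner ℝ v (e l x) • mvfderiv (𝓡 3) f x (e l x) := by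
  conv_lhs => rw [h.eq_sum hx v]
  simp only [map_sum, map_smul]

variable [IsContMDiffRiemannianBundle (𝓡 3) ∞ E3 (fun x : M ↦ TangentSpace (𝓡 3) x)]
  {X Y Z : (x : M) → TangentSpace (𝓡 3) x}

lemma mvfderiv_inner_eq_zero (h : IsOrthoFrameOn e U) (hx : x ∈ U) (a b : Fin 3)
    (v : TangentSpace (𝓡 3) x) :
    mvfderiv (𝓡 3) (fun y ↦ inner ℝ (e a y) (e b y)) x v = 0 := by
  have : (fun y ↦ inner ℝ (e a y) (e b y)) =ᶠ[𝓝 x] fun _ ↦ (if a = b then 1 else 0 : ℝ) := by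
    filter_upwards [h.isOpen.mem_nhds hx] with y hy using h.inner_eq hy a b
  rw [mvfderiv_congr this, mvfderiv_const]
  rfl

/-- Differentiate the constant `⟨e_a, e_b⟩` and use that the connection is metric. -/
lemma connForm_antisymm (h : IsOrthoFrameOn e U) (hx : x ∈ U) (k a b : Fin 3) :
    connForm e k a b x = -connForm e k b a x := by
  have h1 := mvfderiv_inner (h.fieldDiffAt hx k) (h.fieldDiffAt hx a) (h.fieldDiffAt hx b)
  rw [h.mvfderiv_inner_eq_zero hx, real_inner_comm (leviCivita (e k) (e b) x)] at h1
  rw [connForm, connForm]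
  linarith

lemma inner_mlieBracket_frame (h : IsOrthoFrameOn e U) (hx : x ∈ U) (l k m : Fin 3) :
    inner ℝ (mlieBracket (𝓡 3) (e l) (e k) x) (e m x) =
      connForm e l k m x - connForm e k l m x :=
  inner_mlieBracket (h.fieldDiffAt hx l) (h.fieldDiffAt hx k) (h.fieldDiffAt hx m)

lemma mlieBracket_frame (h : IsOrthoFrameOn e U) (hx : x ∈ U) (l k : Fin 3) :
    mlieBracket (𝓡 3) (e l) (e k) x =
      ∑ m, (connForm e l k m x - connForm e k l m x) • e m x := by
  rw [h.eq_sum hx (mlieBracket (𝓡 3) (e l) (e k) x)]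
  simp only [h.inner_mlieBracket_frame hx]

/-- Inner products of frame fields are constant, so only the bracket terms of the Koszul formula
survive, and brackets of smooth fields are smooth. -/
lemma contMDiffOn_connForm (h : IsOrthoFrameOn e U) (k a b : Fin 3) :
    ContMDiffOn (𝓡 3) 𝓘(ℝ) ∞ (connForm e k a b) U := by
  intro x hx
  have hbr (l m n : Fin 3) : ContMDiffAt (𝓡 3) 𝓘(ℝ) ∞
      (fun y ↦ inner ℝ (mlieBracket (𝓡 3) (e l) (e m) y) (e n y)) x := by
    exact ContMDiffAt.inner_bundle
      (contMDiffAt_mlieBracket (h.contMDiffAt hx l) (h.contMDiffAt hx m)) (h.contMDiffAt hx n)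
  have hev : connForm e k a b =ᶠ[𝓝 x] fun y ↦ (1 / 2) *
      (inner ℝ (mlieBracket (𝓡 3) (e k) (e a) y) (e b y)
        - inner ℝ (mlieBracket (𝓡 3) (e k) (e b) y) (e a y)
        - inner ℝ (mlieBracket (𝓡 3) (e a) (e b) y) (e k y)) := by
    filter_upwards [h.isOpen.mem_nhds hx] with y hy
    rw [connForm, inner_leviCivita (h.fieldDiffAt hy k) (h.fieldDiffAt hy a) (h.fieldDiffAt hy b),
      koszul, h.mvfderiv_inner_eq_zero hy, h.mvfderiv_inner_eq_zero hy,
      h.mvfderiv_inner_eq_zero hy]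
    ring
  refine (ContMDiffAt.congr_of_eventuallyEq ?_ hev).contMDiffWithinAt
  exact contMDiffAt_const.mul (((hbr k a b).sub (hbr k b a)).sub (hbr a b k))

lemma contMDiffAt_connForm (h : IsOrthoFrameOn e U) (hx : x ∈ U) (k a b : Fin 3) :
    ContMDiffAt (𝓡 3) 𝓘(ℝ) ∞ (connForm e k a b) x :=
  (h.contMDiffOn_connForm k a b).contMDiffAt (h.isOpen.mem_nhds hx)

lemma mdifferentiableAt_connForm (h : IsOrthoFrameOn e U) (hx : x ∈ U) (k a b : Fin 3) :
    MDifferentiableAt (𝓡 3) 𝓘(ℝ) (connForm e k a b) x :=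
  (h.contMDiffAt_connForm hx k a b).mdifferentiableAt (by simp)

/-- The components of `∇_X Y` in an orthonormal frame. -/
lemma inner_leviCivita_frame (h : IsOrthoFrameOn e U) (hx : x ∈ U) (hX : FieldDiffAt X x)
    (hY : FieldDiffAt Y x) (b : Fin 3) :
    inner ℝ (leviCivita X Y x) (e b x) =
      mvfderiv (𝓡 3) (fun y ↦ inner ℝ (Y y) (e b y)) x (X x) +
      ∑ k, ∑ a, inner ℝ (X x) (e k x) * inner ℝ (Y x) (e a x) * connForm e k a b x := by
  -- Metric compatibility moves the derivative from `Y` to `e_b`: the component `⟨∇_X Y, e_b⟩` is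
  -- `X⟨Y, e_b⟩ - ⟨Y, ∇_X e_b⟩`.
  have h1 := mvfderiv_inner hX hY (h.fieldDiffAt hx b)
  have h2 (a : Fin 3) : inner ℝ (leviCivita X (e b) x) (e a x) =
      ∑ k, inner ℝ (X x) (e k x) * connForm e k b a x := by
    have ht := koszul_tensorial_left (h.fieldDiffAt hx b) (h.fieldDiffAt hx a)
    rw [inner_leviCivita hX (h.fieldDiffAt hx b) (h.fieldDiffAt hx a),
      ← TensorialAt.mkHom_apply ht hX]
    conv_lhs => rw [h.eq_sum hx (X x)]
    rw [map_sum]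
    refine Finset.sum_congr rfl fun k _ ↦ ?_
    rw [map_smul, TensorialAt.mkHom_apply ht (h.fieldDiffAt hx k), connForm,
      inner_leviCivita (h.fieldDiffAt hx k) (h.fieldDiffAt hx b) (h.fieldDiffAt hx a), smul_eq_mul]
  have h3 : inner ℝ (Y x) (leviCivita X (e b) x) =
      -∑ k, ∑ a, inner ℝ (X x) (e k x) * inner ℝ (Y x) (e a x) * connForm e k a b x := by
    conv_lhs => rw [h.eq_sum hx (Y x)]
    rw [sum_inner, Finset.sum_comm, ← Finset.sum_neg_distrib]
    refine Finset.sum_congr rfl fun a _ ↦ ?_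
    rw [inner_smul_left, real_inner_comm (leviCivita X (e b) x), h2, Finset.mul_sum, ← Finset.sum_neg_distrib]
    refine Finset.sum_congr rfl fun k _ ↦ ?_
    rw [h.connForm_antisymm hx k b a]
    simp
    ring
  rw [h3] at h1
  linarith

/-- The algebra behind the expression of the curvature tensor in a frame. -/
lemma curvature_component_identity (w : Fin 3 → Fin 3 → Fin 3 → ℝ)
    (dw : Fin 3 → Fin 3 → Fin 3 → Fin 3 → ℝ) (X Y Z XY YX XZ YZ : Fin 3 → ℝ) (XYZ YXZ LZ : ℝ)
    (hL : XYZ - YXZ = LZ) (b : Fin 3) :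
    (XYZ + ∑ k, ∑ a, (XY k * Z a * w k a b + Y k * XZ a * w k a b +
          Y k * Z a * ∑ l, X l * dw l k a b) +
        ∑ k, ∑ a, X k * (YZ a + ∑ m, ∑ c, Y m * Z c * w m c a) * w k a b)
      - (YXZ + ∑ k, ∑ a, (YX k * Z a * w k a b + X k * YZ a * w k a b +
          X k * Z a * ∑ l, Y l * dw l k a b) +
        ∑ k, ∑ a, Y k * (XZ a + ∑ m, ∑ c, X m * Z c * w m c a) * w k a b)
      - (LZ + ∑ k, ∑ a, ((XY k + ∑ l, ∑ m, X l * Y m * w l m k) -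
          (YX k + ∑ l, ∑ m, Y l * X m * w l m k)) * Z a * w k a b) =
    ∑ l, ∑ k, ∑ a, X l * Y k * Z a * (dw l k a b - dw k l a b
      + ∑ c, (w k a c * w l c b - w l a c * w k c b) - ∑ m, (w l k m - w k l m) * w m a b) := by
  -- Second derivatives of the components of `Z` enter only through the commutator `XYZ - YXZ`; all
  -- first derivatives of components cancel, which is the tensoriality of the curvature.
  subst hL
  simp only [Fin.sum_univ_three]
  ring

end IsOrthoFrameOn

end OrthoFrame

/-! ### Riemann and scalar curvature in a frame -/

section Curvature

variable {M : Type*} [TopologicalSpace M] [ChartedSpace E3 M] [IsManifold (𝓡 3) ∞ M]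
  [Bundle.RiemannianBundle (fun x : M ↦ TangentSpace (𝓡 3) x)]
  [IsContMDiffRiemannianBundle (𝓡 3) ∞ E3 (fun x : M ↦ TangentSpace (𝓡 3) x)]

/-- A vector field is smooth at a point. -/
abbrev FieldSmoothAt {M : Type*} [TopologicalSpace M] [ChartedSpace E3 M] [IsManifold (𝓡 3) ∞ M]
    (X : (x : M) → TangentSpace (𝓡 3) x) (x : M) : Prop :=
  ContMDiffAt (𝓡 3) (𝓡 3).tangent ∞ (fun y ↦ (⟨y, X y⟩ : TangentBundle (𝓡 3) M)) x

lemma FieldSmoothAt.fieldDiffAt {X : (x : M) → TangentSpace (𝓡 3) x} {x : M}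
    (hX : FieldSmoothAt X x) : FieldDiffAt X x := hX.mdifferentiableAt (by simp)

/-- The derivative of a `C²` function along a differentiable vector field is differentiable. -/
lemma mdifferentiableAt_mvfderiv {F : Type*} [NormedAddCommGroup F] [NormedSpace ℝ F] {f : M → F}
    {x : M} (hf : ContMDiffAt (𝓡 3) 𝓘(ℝ, F) 2 f x) {Y : (x : M) → TangentSpace (𝓡 3) x}
    (hY : FieldDiffAt Y x) :
    MDifferentiableAt (𝓡 3) 𝓘(ℝ, F) (fun y ↦ mvfderiv (𝓡 3) f y (Y y)) x :=
  (mvfderiv_mvfderiv_eq hf Y hY).1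

lemma FieldSmoothAt.eventually {X : (x : M) → TangentSpace (𝓡 3) x} {x : M}
    (hX : FieldSmoothAt X x) : ∀ᶠ y in 𝓝 x, FieldDiffAt X y := by
  have h1 : ContMDiffAt (𝓡 3) (𝓡 3).tangent 1
    (fun y ↦ (⟨y, X y⟩ : TangentBundle (𝓡 3) M)) x := hX.of_le (by simp)
  have h2 := (contMDiffAt_iff_contMDiffAt_nhds (n := 1) (by simp)).1 h1
  filter_upwards [h2] with y hy using hy.mdifferentiableAt (by simp)

namespace IsOrthoFrameOn

variable {e : Fin 3 → (x : M) → TangentSpace (𝓡 3) x} {U : Set M} {x : M}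
  {X Y Z : (x : M) → TangentSpace (𝓡 3) x}

lemma contMDiffAt_component (h : IsOrthoFrameOn e U) (hx : x ∈ U) (hX : FieldSmoothAt X x)
    (a : Fin 3) : ContMDiffAt (𝓡 3) 𝓘(ℝ) ∞ (fun y ↦ inner ℝ (X y) (e a y)) x :=
  ContMDiffAt.inner_bundle hX (h.contMDiffAt hx a)

lemma eventually_inner_leviCivita (h : IsOrthoFrameOn e U) (hx : x ∈ U) (hY : FieldSmoothAt Y x)
    (hZ : FieldSmoothAt Z x) (b : Fin 3) :
    (fun y ↦ inner ℝ (leviCivita Y Z y) (e b y)) =ᶠ[𝓝 x] fun y ↦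
      mvfderiv (𝓡 3) (fun y ↦ inner ℝ (Z y) (e b y)) y (Y y) +
      ∑ k, ∑ a, inner ℝ (Y y) (e k y) * inner ℝ (Z y) (e a y) * connForm e k a b y := by
  filter_upwards [h.isOpen.mem_nhds hx, hY.eventually, hZ.eventually] with y hy hYy hZy
  exact h.inner_leviCivita_frame hy hYy hZy b

/-- Needed for fields such as `∇_Y Z`, which are defined through a basis chosen separately at each
point, with no regularity in the point. -/
lemma fieldDiffAt_of_components (h : IsOrthoFrameOn e U) (hx : x ∈ U)
    (hX : ∀ a, MDifferentiableAt (𝓡 3) 𝓘(ℝ) (fun y ↦ inner ℝ (X y) (e a y)) x) :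
    FieldDiffAt X x := by
  have h1 : MDifferentiableAt (𝓡 3) (𝓡 3).tangent (fun y ↦
      (⟨y, ∑ a, inner ℝ (X y) (e a y) • e a y⟩ : TangentBundle (𝓡 3) M)) x :=
    MDifferentiableAt.sum_section fun a _ ↦ (hX a).smul_section (h.fieldDiffAt hx a)
  refine h1.congr_of_eventuallyEq ?_
  filter_upwards [h.isOpen.mem_nhds hx] with y hy
  rw [← h.eq_sum hy (X y)]

/-- The derivative of the components of `∇_Y Z`. -/
lemma mvfderiv_component_leviCivita (h : IsOrthoFrameOn e U) (hx : x ∈ U) (hY : FieldSmoothAt Y x)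
    (hZ : FieldSmoothAt Z x) (b : Fin 3) (v : TangentSpace (𝓡 3) x) :
    HasDirDeriv (fun y ↦ inner ℝ (leviCivita Y Z y) (e b y)) x v
      (mvfderiv (𝓡 3) (fun y ↦ mvfderiv (𝓡 3) (fun y ↦ inner ℝ (Z y) (e b y)) y (Y y)) x v +
      ∑ k, ∑ a,
        (mvfderiv (𝓡 3) (fun y ↦ inner ℝ (Y y) (e k y)) x v * inner ℝ (Z x) (e a x) *
            connForm e k a b x +
          inner ℝ (Y x) (e k x) * mvfderiv (𝓡 3) (fun y ↦ inner ℝ (Z y) (e a y)) x v *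
            connForm e k a b x +
          inner ℝ (Y x) (e k x) * inner ℝ (Z x) (e a x) *
            ∑ l, inner ℝ v (e l x) * mvfderiv (𝓡 3) (connForm e k a b) x (e l x))) := by
  have hYc (k : Fin 3) := (h.contMDiffAt_component hx hY k).mdifferentiableAt (by simp)
  have hZc (k : Fin 3) := (h.contMDiffAt_component hx hZ k).mdifferentiableAt (by simp)
  have hw (k a : Fin 3) := h.mdifferentiableAt_connForm hx k a b
  have hD : MDifferentiableAt (𝓡 3) 𝓘(ℝ)
      (fun y ↦ mvfderiv (𝓡 3) (fun y ↦ inner ℝ (Z y) (e b y)) y (Y y)) x :=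
    mdifferentiableAt_mvfderiv ((h.contMDiffAt_component hx hZ b).of_le ENat.LEInfty.out) hY.fieldDiffAt
  refine HasDirDeriv.congr_of_eventuallyEq ?_ (h.eventually_inner_leviCivita hx hY hZ b)
  refine (hD.hasDirDeriv v).add (HasDirDeriv.sum fun k _ ↦ HasDirDeriv.sum fun a _ ↦ ?_)
  convert! (((hYc k).hasDirDeriv v).mul ((hZc a).hasDirDeriv v)).mul ((hw k a).hasDirDeriv v) using 1
  rw [h.mvfderiv_eq_sum hx (connForm e k a b) v]
  simp only [smul_eq_mul]
  ring

/-- The curvature tensor in terms of an orthonormal frame. -/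
lemma inner_riemannCurvature (h : IsOrthoFrameOn e U) (hx : x ∈ U) (hX : FieldSmoothAt X x)
    (hY : FieldSmoothAt Y x) (hZ : FieldSmoothAt Z x) (b : Fin 3) :
    inner ℝ (riemannCurvature X Y Z x) (e b x) =
      ∑ l, ∑ k, ∑ a, inner ℝ (X x) (e l x) * inner ℝ (Y x) (e k x) * inner ℝ (Z x) (e a x) *
        curvCoeff e l k a b x := by
  have hYZ : FieldDiffAt (leviCivita Y Z) x := h.fieldDiffAt_of_components hx fun a ↦
    (h.mvfderiv_component_leviCivita hx hY hZ a (X x)).1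
  have hXZ : FieldDiffAt (leviCivita X Z) x := h.fieldDiffAt_of_components hx fun a ↦
    (h.mvfderiv_component_leviCivita hx hX hZ a (X x)).1
  have hXY : FieldDiffAt (mlieBracket (𝓡 3) X Y) x :=
    (contMDiffAt_mlieBracket hX hY).mdifferentiableAt (by simp)
  have hbr (k : Fin 3) := inner_mlieBracket hX.fieldDiffAt hY.fieldDiffAt (h.fieldDiffAt hx k)
  -- Supplies `hL` of `curvature_component_identity`: `X(Y Z_b) - Y(X Z_b) = [X,Y] Z_b` for the
  -- component `Z_b`.
  have hcomm := mvfderiv_comm ((h.contMDiffAt_component hx hZ b).of_le ENat.LEInfty.out) hX.fieldDiffAt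
    hY.fieldDiffAt
  rw [riemannCurvature, inner_sub_left, inner_sub_left,
    h.inner_leviCivita_frame hx hX.fieldDiffAt hYZ, h.inner_leviCivita_frame hx hY.fieldDiffAt hXZ,
    h.inner_leviCivita_frame hx hXY hZ.fieldDiffAt,
    (h.mvfderiv_component_leviCivita hx hY hZ b (X x)).2,
    (h.mvfderiv_component_leviCivita hx hX hZ b (Y x)).2]
  simp only [hbr, h.inner_leviCivita_frame hx hX.fieldDiffAt hY.fieldDiffAt,
    h.inner_leviCivita_frame hx hY.fieldDiffAt hX.fieldDiffAt,
    h.inner_leviCivita_frame hx hX.fieldDiffAt hZ.fieldDiffAt,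
    h.inner_leviCivita_frame hx hY.fieldDiffAt hZ.fieldDiffAt]
  exact curvature_component_identity (fun k a b ↦ connForm e k a b x)
    (fun l k a b ↦ mvfderiv (𝓡 3) (connForm e k a b) x (e l x)) _ _ _ _ _ _ _ _ _ _ hcomm b

/-- The scalar curvature in terms of an orthonormal frame. -/
lemma scalarCurvature_eq (h : IsOrthoFrameOn e U) (hx : x ∈ U) :
    scalarCurvature x = ∑ l, ∑ k, curvCoeff e l k k l x := by
  set b := stdOrthonormalBasis ℝ (TangentSpace (𝓡 3) x) with hb
  have hsm (v : TangentSpace (𝓡 3) x) : FieldSmoothAt (FiberBundle.extend E3 v) x :=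
    FiberBundle.contMDiffAt_extend (𝓡 3) E3 v
  have hR (i j) : inner ℝ
      (riemannCurvature (FiberBundle.extend E3 (b i)) (FiberBundle.extend E3 (b j))
        (FiberBundle.extend E3 (b j)) x) (b i) =
      ∑ d, ∑ l, ∑ k, ∑ a, curvCoeff e l k a d x * (inner ℝ (e l x) (b i) * inner ℝ (b i) (e d x)) *
        (inner ℝ (e k x) (b j) * inner ℝ (b j) (e a x)) := by
    rw [h.eq_sum hx (riemannCurvature _ _ _ x), sum_inner]
    refine Finset.sum_congr rfl fun d _ ↦ ?_
    rw [h.inner_riemannCurvature hx (hsm _) (hsm _) (hsm _) d, inner_smul_left]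
    simp only [FiberBundle.extend_apply_self, RCLike.conj_to_real, Finset.sum_mul]
    refine Finset.sum_congr rfl fun l _ ↦ Finset.sum_congr rfl fun k _ ↦
      Finset.sum_congr rfl fun a _ ↦ ?_
    rw [real_inner_comm (b i) (e l x), real_inner_comm (b j) (e k x), real_inner_comm (b i) (e d x)]
    ring
  have hswap {α β γ : Type} [Fintype α] [Fintype β] [Fintype γ] (G : α → β → γ → ℝ) :
      ∑ i, ∑ j, ∑ d, G i j d = ∑ d, ∑ i, ∑ j, G i j d :=
    (Finset.sum_congr rfl fun i _ ↦ Finset.sum_comm).trans Finset.sum_comm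
  rw [scalarCurvature]
  simp only [← hb, hR]
  calc _ = ∑ d, ∑ l, ∑ k, ∑ a, curvCoeff e l k a d x *
      inner ℝ (e l x) (e d x) * inner ℝ (e k x) (e a x) := by
        rw [hswap]
        refine Finset.sum_congr rfl fun d _ ↦ ?_
        rw [hswap]
        refine Finset.sum_congr rfl fun l _ ↦ ?_
        rw [hswap]
        refine Finset.sum_congr rfl fun k _ ↦ ?_
        rw [hswap]
        refine Finset.sum_congr rfl fun a _ ↦ ?_
        -- Parseval: summing over the basis `b` from the definition contracts the frame indices, `∑
        -- ⟨e_l, b_i⟩⟨b_i, e_d⟩ = ⟨e_l, e_d⟩`.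
        rw [← b.sum_inner_mul_inner (e l x), ← b.sum_inner_mul_inner (e k x), mul_assoc,
          Finset.sum_mul_sum, Finset.mul_sum]
        refine Finset.sum_congr rfl fun i _ ↦ ?_
        rw [Finset.mul_sum]
        exact Finset.sum_congr rfl fun j _ ↦ by ring
    _ = _ := by
        simp only [h.inner_eq hx]
        simp [Finset.sum_ite_eq]

lemma continuousAt_curvCoeff (h : IsOrthoFrameOn e U) (hx : x ∈ U) (l k a b : Fin 3) :
    ContinuousAt (curvCoeff e l k a b) x := by
  have hd (l k a b : Fin 3) :
      ContinuousAt (fun y ↦ mvfderiv (𝓡 3) (connForm e k a b) y (e l y)) x :=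
    (mdifferentiableAt_mvfderiv ((h.contMDiffAt_connForm hx k a b).of_le ENat.LEInfty.out)
      (h.fieldDiffAt hx l)).continuousAt
  have hc (k a b : Fin 3) : ContinuousAt (connForm e k a b) x :=
    (h.contMDiffAt_connForm hx k a b).continuousAt
  unfold curvCoeff
  refine (((hd l k a b).sub (hd k l a b)).add ?_).sub ?_
  · exact tendsto_finsetSum _ fun c _ ↦ ((hc k a c).mul (hc l c b)).sub ((hc l a c).mul (hc k c b))
  · exact tendsto_finsetSum _ fun m _ ↦ ((hc l k m).sub (hc k l m)).mul (hc m a b)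

lemma continuousAt_scalarCurvature (h : IsOrthoFrameOn e U) (hx : x ∈ U) :
    ContinuousAt (scalarCurvature (M := M)) x := by
  have : ContinuousAt (fun y ↦ ∑ l, ∑ k, curvCoeff e l k k l y) x :=
    tendsto_finsetSum _ fun l _ ↦ tendsto_finsetSum _ fun k _ ↦
      h.continuousAt_curvCoeff hx l k k l
  refine this.congr ?_
  filter_upwards [h.isOpen.mem_nhds hx] with y hy using (h.scalarCurvature_eq hy).symm

end IsOrthoFrameOn

end Curvature

/-! ### The Weitzenböck formula as linear algebra -/

section CliffordModule

variable {V : Type*} [NormedAddCommGroup V] [InnerProductSpace ℝ V]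

/-- An orthogonal action of the quaternions `c 0, c 1, c 2` together with a commuting orthogonal
complex structure `J`. -/
structure IsCliffordModule (c : Fin 3 → V →ₗ[ℝ] V) (J : V →ₗ[ℝ] V) : Prop where
  sq (k : Fin 3) (v : V) : c k (c k v) = -v
  mul01 (v : V) : c 0 (c 1 v) = c 2 v
  mul10 (v : V) : c 1 (c 0 v) = -c 2 v
  mul12 (v : V) : c 1 (c 2 v) = c 0 v
  mul21 (v : V) : c 2 (c 1 v) = -c 0 v
  mul20 (v : V) : c 2 (c 0 v) = c 1 v
  mul02 (v : V) : c 0 (c 2 v) = -c 1 v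
  comm (k : Fin 3) (v : V) : c k (J v) = J (c k v)
  sqJ (v : V) : J (J v) = -v
  skew (k : Fin 3) (v w : V) : inner ℝ (c k v) w = -inner ℝ v (c k w)
  skewJ (v w : V) : inner ℝ (J v) w = -inner ℝ v (J w)

/-- The endomorphism `½ ∑_{a<b} w_{ab} c_a c_b + ½ a J`. -/
def spinConn (c : Fin 3 → V →ₗ[ℝ] V) (J : V →ₗ[ℝ] V) (w : Fin 3 → Fin 3 → ℝ) (a : ℝ) :
    V →ₗ[ℝ] V :=
  (1 / 2 : ℝ) • (w 1 2 • c 0 + w 2 0 • c 1 + w 0 1 • c 2) + (1 / 2 * a) • J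

/-- The curvature of connection coefficients `w` with derivatives `dw`. -/
def curvOf (w : Fin 3 → Fin 3 → Fin 3 → ℝ) (dw : Fin 3 → Fin 3 → Fin 3 → Fin 3 → ℝ)
    (l k a b : Fin 3) : ℝ :=
  dw l k a b - dw k l a b + ∑ c, (w k a c * w l c b - w l a c * w k c b)
    - ∑ m, (w l k m - w k l m) * w m a b

namespace IsCliffordModule

variable {c : Fin 3 → V →ₗ[ℝ] V} {J : V →ₗ[ℝ] V}

/-- The spin connection is metric: its coefficient is a real combination of skew endomorphisms. -/
lemma inner_spinConn (hc : IsCliffordModule c J) (w : Fin 3 → Fin 3 → ℝ) (a : ℝ) (u v : V) :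
    inner ℝ (spinConn c J w a u) v = -inner ℝ u (spinConn c J w a v) := by
  simp only [spinConn, LinearMap.add_apply, LinearMap.smul_apply, inner_add_left, inner_add_right,
    real_inner_smul_left, real_inner_smul_right, hc.skew, hc.skewJ]
  ring

variable (w : Fin 3 → Fin 3 → Fin 3 → ℝ) (dw : Fin 3 → Fin 3 → Fin 3 → Fin 3 → ℝ)
  (a : Fin 3 → ℝ) (da : Fin 3 → Fin 3 → ℝ) (φ : V) (p : Fin 3 → V) (P : Fin 3 → Fin 3 → V)

/-- The curvature of the connection with coefficients `a`. -/
def fieldStrength (m : Fin 3) : ℝ :=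
  da (m + 1) (m + 2) - da (m + 2) (m + 1) -
    ∑ j, (w (m + 1) (m + 2) j - w (m + 2) (m + 1) j) * a j

/-- The Weitzenböck formula for a harmonic spinor, at a point. -/
lemma weitzenboeck (hc : IsCliffordModule c J)
    (hw : ∀ k a b, w k a b = -w k b a) (hdw : ∀ l k a b, dw l k a b = -dw l k b a)
    (hP : ∀ l k, P l k - P k l = ∑ m, (w l k m - w k l m) • p m)
    (hD : ∑ k, c k (p k + spinConn c J (w k) (a k) φ) = 0)
    (hdD : ∀ l, ∑ k, c k (P l k + (spinConn c J (dw l k) (da l k) φ +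
      spinConn c J (w k) (a k) (p l))) = 0) :
    ∑ k, (P k k + (spinConn c J (dw k k) (da k k) φ + spinConn c J (w k) (a k) (p k)) +
        spinConn c J (w k) (a k) (p k + spinConn c J (w k) (a k) φ)) +
      ∑ k, (∑ l, w l k l) • (p k + spinConn c J (w k) (a k) φ) =
    (1 / 2 : ℝ) • ∑ m, c m (∑ n, curvOf w dw (m + 1) (m + 2) (n + 1) (n + 2) • c n φ +
      fieldStrength w a da m • J φ) := by
  -- Together with `hdD'` this gives `∑ c_l ∇_l (D φ) = 0`, that is `D²φ = 0` written in the frame.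
  have hD' (l : Fin 3) := congrArg (fun v ↦ c l (spinConn c J (w l) (a l) v)) hD
  have hdD' (l : Fin 3) := congrArg (fun v ↦ c l v) (hdD l)
  -- In `D²φ` the mixed second derivatives occur as `c_0 c_1 (P_01 - P_10)` and cyclically. With
  -- `c_0 c_1 = c_2` each is a Clifford multiple of a commutator, which `hP` rewrites as first
  -- derivatives.
  have h10 := congrArg (c 2) (hP 1 0)
  have h20 := congrArg (c 1) (hP 2 0)
  have h21 := congrArg (c 0) (hP 2 1)
  have w00 (k i : Fin 3) : w k i i = 0 := by linarith [hw k i i]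
  have dw00 (l k i : Fin 3) : dw l k i i = 0 := by linarith [hdw l k i i]
  have e10 (k : Fin 3) : w k 1 0 = - w k 0 1 := hw k 1 0
  have e20 (k : Fin 3) : w k 0 2 = - w k 2 0 := hw k 0 2
  have e21 (k : Fin 3) : w k 2 1 = - w k 1 2 := hw k 2 1
  have d10 (l k : Fin 3) : dw l k 1 0 = - dw l k 0 1 := hdw l k 1 0
  have d20 (l k : Fin 3) : dw l k 0 2 = - dw l k 2 0 := hdw l k 0 2
  have d21 (l k : Fin 3) : dw l k 2 1 = - dw l k 1 2 := hdw l k 2 1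
  have i1 : (1 : Fin 3) + 1 = 2 := rfl
  have i2 : (1 : Fin 3) + 2 = 0 := rfl
  have i3 : (2 : Fin 3) + 1 = 0 := rfl
  have i4 : (2 : Fin 3) + 2 = 1 := rfl
  have hD0 := hD' 0
  have hD1 := hD' 1
  have hD2 := hD' 2
  have hE0 := hdD' 0
  have hE1 := hdD' 1
  have hE2 := hdD' 2
  clear hD' hdD' hD hdD hP hw hdw
  simp only [Fin.sum_univ_three, spinConn, LinearMap.add_apply, LinearMap.smul_apply, map_add,
    map_sub, map_smul, map_neg, map_zero, smul_add, smul_neg, smul_smul,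
    hc.sq, hc.mul01, hc.mul10, hc.mul12, hc.mul21, hc.mul20, hc.mul02, hc.comm, hc.sqJ,
    curvOf, fieldStrength, zero_add, i1, i2, i3, i4, w00, dw00, e10, e20, e21, d10, d20, d21] at *
  linear_combination (norm := module) -hE0 - hE1 - hE2 - hD0 - hD1 - hD2 - h10 - h21 + h20

lemma inner_spinConn_self (hc : IsCliffordModule c J) (w : Fin 3 → Fin 3 → ℝ) (a : ℝ) (v : V) :
    inner ℝ (spinConn c J w a v) v = 0 := by
  have := hc.inner_spinConn w a v v
  rw [real_inner_comm] at this ⊢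
  linarith

/-- For `m ≠ n` the product `c_m c_n` is `±c_k`, which is skew. Pairing the Weitzenböck formula with
`φ` therefore keeps only the diagonal curvature coefficients. -/
lemma inner_clifford_clifford (hc : IsCliffordModule c J) (m n : Fin 3) (v : V) :
    inner ℝ (c m (c n v)) v = if m = n then -‖v‖ ^ 2 else 0 := by
  have h0 (k : Fin 3) : inner ℝ (c k v) v = 0 := by
    have := hc.skew k v v
    rw [real_inner_comm] at this ⊢
    linarith
  fin_cases m <;> fin_cases n <;>
    simp [hc.sq, hc.mul01, hc.mul10, hc.mul12, hc.mul21, hc.mul20, hc.mul02, h0]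

/-- Each plane occurs twice in the double sum, and reversing the last index pair changes the sign:
hence `-2`. -/
lemma curvOf_trace (hw : ∀ k a b, w k a b = -w k b a)
    (hdw : ∀ l k a b, dw l k a b = -dw l k b a) :
    ∑ l, ∑ k, curvOf w dw l k k l = -2 * ∑ m, curvOf w dw (m + 1) (m + 2) (m + 1) (m + 2) := by
  have w00 (k i : Fin 3) : w k i i = 0 := by linarith [hw k i i]
  have dw00 (l k i : Fin 3) : dw l k i i = 0 := by linarith [hdw l k i i]
  have i1 : (1 : Fin 3) + 1 = 2 := rfl
  have i2 : (1 : Fin 3) + 2 = 0 := rfl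
  have i3 : (2 : Fin 3) + 1 = 0 := rfl
  have i4 : (2 : Fin 3) + 2 = 1 := rfl
  simp only [Fin.sum_univ_three, curvOf, zero_add, i1, i2, i3, i4, w00, dw00, fun k ↦ hw k 1 0,
    fun k ↦ hw k 0 2, fun k ↦ hw k 2 1, fun l k ↦ hdw l k 1 0, fun l k ↦ hdw l k 0 2,
    fun l k ↦ hdw l k 2 1]
  ring

/-- The pointwise estimate for a monopole at a point where `|φ|²` has a maximum. -/
lemma curvature_estimate (hc : IsCliffordModule c J)
    (hw : ∀ k a b, w k a b = -w k b a) (hdw : ∀ l k a b, dw l k a b = -dw l k b a)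
    (hP : ∀ l k, P l k - P k l = ∑ m, (w l k m - w k l m) • p m)
    (hD : ∑ k, c k (p k + spinConn c J (w k) (a k) φ) = 0)
    (hdD : ∀ l, ∑ k, c k (P l k + (spinConn c J (dw l k) (da l k) φ +
      spinConn c J (w k) (a k) (p l))) = 0)
    (hF : ∀ m, fieldStrength w a da m = 1 / 4 * inner ℝ (c m (J φ)) φ)
    (hφ : ∑ m, inner ℝ (c m (J φ)) φ ^ 2 = ‖φ‖ ^ 4)
    (h1 : ∀ k, inner ℝ (p k) φ = 0) (h2 : ∀ k, inner ℝ (P k k) φ + ‖p k‖ ^ 2 ≤ 0) :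
    1 / 4 * (∑ l, ∑ k, curvOf w dw l k k l) * ‖φ‖ ^ 2 + 1 / 8 * ‖φ‖ ^ 4 ≤ 0 := by
  -- Paired with `φ`, the terms containing `dw` and `da` vanish by skewness, and the first-order
  -- drift term vanishes by skewness and `h1`.
  have hW := congrArg (fun v ↦ inner ℝ v φ) (weitzenboeck w dw a da φ p P hc hw hdw hP hD hdD)
  simp only [inner_add_left, sum_inner, real_inner_smul_left, map_add, map_sum, map_smul,
    hc.inner_spinConn_self, h1, hc.inner_clifford_clifford, add_zero, mul_zero,
    Finset.sum_const_zero, zero_add, Finset.sum_add_distrib, mul_ite, Finset.sum_ite_eq,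
    Finset.mem_univ, if_true, hF] at hW
  have hR : ∑ m, 1 / 4 * inner ℝ (c m (J φ)) φ * inner ℝ (c m (J φ)) φ = 1 / 4 * ‖φ‖ ^ 4 := by
    rw [← hφ, Finset.mul_sum]
    exact Finset.sum_congr rfl fun m _ ↦ by ring
  -- By skewness of the connection term `B_k`, the left side is `⟨P_kk, φ⟩ + |p_k|² - |p_k + B_k
  -- φ|²`.
  have hk (k : Fin 3) : inner ℝ (P k k) φ +
      2 * inner ℝ (spinConn c J (w k) (a k) (p k)) φ
      + inner ℝ (spinConn c J (w k) (a k) (spinConn c J (w k) (a k) φ)) φ ≤ 0 := by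
    have h3 := sq_nonneg ‖p k + spinConn c J (w k) (a k) φ‖
    rw [norm_add_sq_real] at h3
    rw [hc.inner_spinConn, hc.inner_spinConn, real_inner_self_eq_norm_sq]
    linarith [h2 k]
  have hs := Finset.sum_nonpos fun k (_ : k ∈ Finset.univ) ↦ hk k
  simp only [Finset.sum_add_distrib, ← Finset.mul_sum] at hs
  rw [hR, ← Finset.sum_mul] at hW
  rw [curvOf_trace w dw hw hdw]
  linarith

end IsCliffordModule

end CliffordModule

/-! ### The spin representation on `ℂ²` -/

section SpinModule

/-- Clifford multiplication by the `k`-th basis vector as a real linear map. -/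
def cliffEnd (k : Fin 3) : Spin2 →ₗ[ℝ] Spin2 :=
  (matAct (cliffordMul (stdVec k))).restrictScalars ℝ

/-- Multiplication by `i` as a real linear map. -/
def imagEnd : Spin2 →ₗ[ℝ] Spin2 :=
  (Complex.I • (LinearMap.id : Spin2 →ₗ[ℂ] Spin2)).restrictScalars ℝ

lemma cliffEnd_apply (k : Fin 3) (v : Spin2) :
    cliffEnd k v = matAct (cliffordMul (stdVec k)) v := rfl

lemma imagEnd_apply (v : Spin2) : imagEnd v = Complex.I • v := rfl

lemma cliffordMul_stdVec (k : Fin 3) : cliffordMul (stdVec k) = (-Complex.I) • pauli k := by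
  simp only [cliffordMul, stdVec, LinearMap.coe_mk, AddHom.coe_mk]
  rw [Finset.sum_eq_single k]
  · simp
  · intro b _ hb
    simp [hb]
  · simp

lemma cliffEnd_zero (v : Spin2) : cliffEnd 0 v = !₂[-Complex.I * v 1, -Complex.I * v 0] := by
  ext i
  fin_cases i <;> simp [cliffEnd_apply, cliffordMul_stdVec, matAct, pauli, Matrix.mulVec, dotProduct]

lemma cliffEnd_one (v : Spin2) : cliffEnd 1 v = !₂[-v 1, v 0] := by
  ext i
  fin_cases i <;> simp [cliffEnd_apply, cliffordMul_stdVec, matAct, pauli, Matrix.mulVec,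
    dotProduct]

lemma cliffEnd_two (v : Spin2) : cliffEnd 2 v = !₂[-Complex.I * v 0, Complex.I * v 1] := by
  ext i
  fin_cases i <;> simp [cliffEnd_apply, cliffordMul_stdVec, matAct, pauli, Matrix.mulVec, dotProduct]

lemma real_inner_spin (v w : Spin2) : inner ℝ v w =
    (v 0).re * (w 0).re + (v 0).im * (w 0).im + ((v 1).re * (w 1).re + (v 1).im * (w 1).im) := by
  rw [PiLp.inner_apply, Fin.sum_univ_two, Complex.inner, Complex.inner]
  simp
  ring

lemma isCliffordModule_spin : IsCliffordModule cliffEnd imagEnd where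
  sq k v := by
    fin_cases k <;> ext i <;> fin_cases i <;>
      simp [cliffEnd_zero, cliffEnd_one, cliffEnd_two, ← mul_assoc]
  mul01 v := by
    ext i; fin_cases i <;> simp [cliffEnd_zero, cliffEnd_one, cliffEnd_two]
  mul10 v := by
    ext i; fin_cases i <;> simp [cliffEnd_zero, cliffEnd_one, cliffEnd_two]
  mul12 v := by
    ext i; fin_cases i <;> simp [cliffEnd_zero, cliffEnd_one, cliffEnd_two]
  mul21 v := by
    ext i; fin_cases i <;> simp [cliffEnd_zero, cliffEnd_one, cliffEnd_two]
  mul20 v := by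
    ext i; fin_cases i <;> simp [cliffEnd_zero, cliffEnd_one, cliffEnd_two, ← mul_assoc]
  mul02 v := by
    ext i; fin_cases i <;> simp [cliffEnd_zero, cliffEnd_one, cliffEnd_two, ← mul_assoc]
  comm k v := by
    fin_cases k <;> ext i <;> fin_cases i <;>
      simp [cliffEnd_zero, cliffEnd_one, cliffEnd_two, imagEnd_apply, ← mul_assoc]
  sqJ v := by
    ext i; fin_cases i <;> simp [imagEnd_apply, ← mul_assoc]
  skew k v w := by
    fin_cases k <;> simp [cliffEnd_zero, cliffEnd_one, cliffEnd_two, real_inner_spin] <;> ring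
  skewJ v w := by
    simp [imagEnd_apply, real_inner_spin]; ring

lemma norm_sq_spin (v : Spin2) :
    ‖v‖ ^ 2 = (v 0).re ^ 2 + (v 0).im ^ 2 + ((v 1).re ^ 2 + (v 1).im ^ 2) := by
  rw [← real_inner_self_eq_norm_sq, real_inner_spin]; ring

/-- Since `c_m(iφ) = σ_m φ`, these are the coordinates of the Hopf map, whose length is `|φ|²`. -/
lemma sum_sq_inner_cliffEnd (φ : Spin2) :
    ∑ m, inner ℝ (cliffEnd m (imagEnd φ)) φ ^ 2 = ‖φ‖ ^ 4 := by
  have : ‖φ‖ ^ 4 = (‖φ‖ ^ 2) ^ 2 := by ring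
  rw [this, norm_sq_spin]
  simp [Fin.sum_univ_three, cliffEnd_zero, cliffEnd_one, cliffEnd_two, real_inner_spin,
    imagEnd_apply]
  ring

/-- Both sides of the curvature equation are imaginary; this real form is where the `1/4` of `hF` in
`curvature_estimate` comes from. -/
lemma quadMap_eq (φ : Spin2) (k : Fin 3) :
    (1 / 2 : ℂ) * SpinCStructure.quadMap φ k =
      Complex.I * ((1 / 4 * inner ℝ (cliffEnd k (imagEnd φ)) φ : ℝ) : ℂ) := by
  have h : inner ℂ φ (cliffEnd k φ) =
      -Complex.I * ((inner ℝ (cliffEnd k (imagEnd φ)) φ : ℝ) : ℂ) := by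
    rw [PiLp.inner_apply, Fin.sum_univ_two]
    apply Complex.ext <;> fin_cases k <;>
      simp [cliffEnd_zero, cliffEnd_one, cliffEnd_two, real_inner_spin, imagEnd_apply] <;> ring
  rw [SpinCStructure.quadMap, ← cliffEnd_apply, h]
  push_cast
  ring

/-- The spin representation turns the involution of the Clifford algebra into the adjoint. -/
lemma spinRep_star (y : Cl3) :
    spinRep ((1 : ℂ) ⊗ₜ[ℝ] star y) = (spinRep ((1 : ℂ) ⊗ₜ[ℝ] y)).conjTranspose := by
  induction y using CliffordAlgebra.induction with
  | algebraMap r =>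
    have h : (1 : ℂ) ⊗ₜ[ℝ] algebraMap ℝ Cl3 r = algebraMap ℝ ClC3 r := by
      rw [Algebra.algebraMap_eq_smul_one, TensorProduct.tmul_smul,
        ← Algebra.TensorProduct.one_def, ← Algebra.algebraMap_eq_smul_one]
    have h' : spinRep (algebraMap ℝ ClC3 r) = algebraMap ℝ (Matrix (Fin 2) (Fin 2) ℂ) r :=
      (spinRep.restrictScalars ℝ).commutes r
    rw [CliffordAlgebra.star_algebraMap, h, h']
    ext i j
    fin_cases i <;> fin_cases j <;> simp [Matrix.algebraMap_matrix_apply]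
  | ι v =>
    have h : (1 : ℂ) ⊗ₜ[ℝ] CliffordAlgebra.ι Q3 v = clVec v := rfl
    rw [CliffordAlgebra.star_ι, TensorProduct.tmul_neg, map_neg, h, spinRep_clVec]
    ext i j
    fin_cases i <;> fin_cases j <;>
      simp [cliffordMul, pauli, Fin.sum_univ_three, Matrix.conjTranspose_apply] <;> ring
  | mul a b ha hb =>
    have h (u v : Cl3) : (1 : ℂ) ⊗ₜ[ℝ] (u * v) = ((1 : ℂ) ⊗ₜ[ℝ] u) * ((1 : ℂ) ⊗ₜ[ℝ] v) := by
      rw [Algebra.TensorProduct.tmul_mul_tmul, one_mul]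
    rw [star_mul, h, h, map_mul, map_mul, ha, hb, Matrix.conjTranspose_mul]
  | add a b ha hb =>
    rw [star_add, TensorProduct.tmul_add, TensorProduct.tmul_add, map_add, map_add, ha, hb,
      Matrix.conjTranspose_add]

/-- The spin representation is unitary. -/
lemma spinRep_mem_unitaryGroup (g : SpinC3) :
    spinRep ((g : ClC3ˣ) : ClC3) ∈ Matrix.unitaryGroup (Fin 2) ℂ := by
  obtain ⟨g, hg⟩ := g
  unfold SpinC3 at hg
  simp only
  induction hg using Subgroup.closure_induction with
  | mem u hu =>
    rcases hu with ⟨x, hx, hu⟩ | ⟨z, hu⟩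
    · rw [Matrix.mem_unitaryGroup_iff, Matrix.star_eq_conjTranspose, hu, ← spinRep_star, ← map_mul,
        Algebra.TensorProduct.tmul_mul_tmul, spinGroup.mul_star_self_of_mem hx, one_mul,
        ← Algebra.TensorProduct.one_def, map_one]
    · have h : (z : ℂ) ⊗ₜ[ℝ] (1 : Cl3) = (z : ℂ) • (1 : ClC3) := by
        rw [Algebra.TensorProduct.one_def, TensorProduct.smul_tmul', smul_eq_mul, mul_one]
      rw [Matrix.mem_unitaryGroup_iff, hu, h, map_smul, map_one, star_smul, star_one, smul_mul_smul,
        mul_one]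
      have : (z : ℂ) * star (z : ℂ) = 1 := by
        rw [Complex.star_def, Complex.mul_conj, Complex.normSq_eq_norm_sq, Circle.norm_coe]
        simp
      rw [this, one_smul]
  | one => simp
  | mul a b _ _ ha hb =>
    rw [Units.val_mul, map_mul]
    exact mul_mem ha hb
  | inv a _ ha =>
    have h : spinRep (a : ClC3) * spinRep ((a⁻¹ : ClC3ˣ) : ClC3) = 1 := by
      rw [← map_mul, Units.mul_inv, map_one]
    have h' : spinRep ((a⁻¹ : ClC3ˣ) : ClC3) = star (spinRep (a : ClC3)) := by
      have h2 := Matrix.mem_unitaryGroup_iff'.1 ha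
      calc _ = (star (spinRep (a : ClC3)) * spinRep (a : ClC3)) *
            spinRep ((a⁻¹ : ClC3ˣ) : ClC3) := by rw [h2, one_mul]
        _ = _ := by rw [mul_assoc, h, mul_one]
    rw [h']
    exact Unitary.star_mem ha

lemma norm_matAct_of_mem_unitaryGroup {T : Matrix (Fin 2) (Fin 2) ℂ}
    (hT : T ∈ Matrix.unitaryGroup (Fin 2) ℂ) (v : Spin2) : ‖matAct T v‖ = ‖v‖ := by
  have h : inner ℂ (matAct T v) (matAct T v) = inner ℂ v v := by
    rw [← LinearMap.adjoint_inner_left, matAct, ← Matrix.toEuclideanLin_conjTranspose_eq_adjoint]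
    have : (Matrix.toEuclideanLin T.conjTranspose) ((Matrix.toEuclideanLin T) v) = v := by
      have h2 := Matrix.mem_unitaryGroup_iff'.1 hT
      rw [Matrix.star_eq_conjTranspose] at h2
      simp only [Matrix.toLpLin_apply, Matrix.mulVec_mulVec, h2, Matrix.one_mulVec]
    rw [this]
  rw [inner_self_eq_norm_sq_to_K, inner_self_eq_norm_sq_to_K] at h
  have h' : ‖matAct T v‖ ^ 2 = ‖v‖ ^ 2 := by exact_mod_cast h
  exact (sq_eq_sq₀ (norm_nonneg _) (norm_nonneg _)).1 h'

end SpinModule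

/-! ### Product rules for spinors -/

section DirDeriv

variable {M : Type*} [TopologicalSpace M] [ChartedSpace E3 M]
  {V : Type*} [NormedAddCommGroup V] [InnerProductSpace ℝ V]
  {x : M} {v : TangentSpace (𝓡 3) x}

lemma HasDirDeriv.inner {f g : M → V} {f' g' : V} (hf : HasDirDeriv f x v f')
    (hg : HasDirDeriv g x v g') :
    HasDirDeriv (fun y ↦ inner ℝ (f y) (g y)) x v (inner ℝ f' (g x) + inner ℝ (f x) g') := by
  have h1 : HasMFDerivAt (𝓡 3) 𝓘(ℝ, V × V) (fun y ↦ (f y, g y)) x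
      ((mvfderiv (𝓡 3) f x).prod (mvfderiv (𝓡 3) g x)) :=
    ⟨hf.1.continuousAt.prodMk hg.1.continuousAt,
      hf.1.hasMFDerivAt.2.prodMk hg.1.hasMFDerivAt.2⟩
  have h2 := ((isBoundedBilinearMap_inner (𝕜 := ℝ) (E := V)).hasFDerivAt
    (f x, g x)).hasMFDerivAt.comp x h1
  refine ⟨h2.mdifferentiableAt, (mvfderiv_eq_of_hasMFDerivAt h2 v).trans ?_⟩
  rw [← hf.2, ← hg.2, add_comm]
  rfl

lemma HasDirDeriv.linearMap_apply [FiniteDimensional ℝ V] (L : V →ₗ[ℝ] V) {f : M → V} {f' : V}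
    (hf : HasDirDeriv f x v f') : HasDirDeriv (fun y ↦ L (f y)) x v (L f') :=
  hf.clm_apply L.toContinuousLinearMap

lemma HasDirDeriv.spinConn [FiniteDimensional ℝ V] (c : Fin 3 → V →ₗ[ℝ] V) (J : V →ₗ[ℝ] V)
    {w : Fin 3 → Fin 3 → M → ℝ} {w' : Fin 3 → Fin 3 → ℝ} {a : M → ℝ} {a' : ℝ} {f : M → V} {f' : V}
    (hw : ∀ i j, HasDirDeriv (w i j) x v (w' i j)) (ha : HasDirDeriv a x v a')
    (hf : HasDirDeriv f x v f') :
    HasDirDeriv (fun y ↦ SeibergWitten.spinConn c J (fun i j ↦ w i j y) (a y) (f y)) x v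
      (SeibergWitten.spinConn c J w' a' (f x) +
        SeibergWitten.spinConn c J (fun i j ↦ w i j x) (a x) f') := by
  have h (i j k : Fin 3) := (hw i j).smul (hf.linearMap_apply (c k))
  have hJ := ha.smul (hf.linearMap_apply J)
  have h1 := (((HasDirDeriv.const (1 / 2 : ℝ) v).smul
    (((h 1 2 0).add (h 2 0 1)).add (h 0 1 2))).add ((HasDirDeriv.const (1 / 2 : ℝ) v).smul hJ))
  convert! h1 using 1
  · funext y
    simp only [SeibergWitten.spinConn, LinearMap.add_apply, LinearMap.smul_apply, mul_smul]
  · simp only [SeibergWitten.spinConn, LinearMap.add_apply, LinearMap.smul_apply]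
    module

end DirDeriv

/-! ### The estimate at a maximum of the spinor norm -/

namespace SpinCStructure

variable {M : Type*} [TopologicalSpace M] [ChartedSpace E3 M] [IsManifold (𝓡 3) ∞ M]
  [Bundle.RiemannianBundle (fun x : M ↦ TangentSpace (𝓡 3) x)]
  {o : ManifoldOrientation M} {S : SpinCStructure o}

lemma isOrthoFrameOn (S : SpinCStructure o) (i : S.ι) : IsOrthoFrameOn (S.e i) (S.U i) where
  isOpen := S.isOpen_U i
  smooth k := S.smooth_frame i (stdVec k)
  orthonormal {x} _ := by
    have h : Orthonormal ℝ (fun k : Fin 3 ↦ stdVec k) := EuclideanSpace.orthonormal_single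
    exact h.comp_linearIsometryEquiv (S.frame (S.sec i x))

/-- The real coefficients of the connection form in the local frame. -/
def formCoeff (A : S.GaugeField) (i : S.ι) (k : Fin 3) (x : M) : ℝ :=
  (A.form i x (S.e i k x)).im

lemma form_eq (A : S.GaugeField) {i : S.ι} {x : M} (hx : x ∈ S.U i) (v : TangentSpace (𝓡 3) x) :
    A.form i x v = Complex.I * ((A.form i x v).im : ℂ) := by
  apply Complex.ext
  · simp [A.imaginary i x v hx]
  · simp

lemma mdifferentiableAt_form (A : S.GaugeField) (hA : A.IsC 2) {i : S.ι} {x : M} (hx : x ∈ S.U i)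
    (k : Fin 3) :
    MDifferentiableAt (𝓡 3) 𝓘(ℝ, ℂ) (fun y ↦ A.form i y (S.e i k y)) x := by
  have h1 := ((hA i).contMDiffAt ((S.isOpen_U i).mem_nhds hx)).mdifferentiableAt (by norm_num)
  have h2 := (S.isOrthoFrameOn i).fieldDiffAt hx k
  have h3 : MDifferentiableAt (𝓡 3) ((𝓡 3).prod 𝓘(ℝ, ℂ))
      (fun m ↦ Bundle.TotalSpace.mk' ℂ (E := Bundle.Trivial M ℂ) m
        (A.form i m (S.e i k m))) x := by
    apply MDifferentiableAt.clm_bundle_apply (F₁ := E3)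
    · exact h1
    · exact h2
  simp only [mdifferentiableAt_totalSpace] at h3
  exact h3.2

variable [IsContMDiffRiemannianBundle (𝓡 3) ∞ E3 (fun x : M ↦ TangentSpace (𝓡 3) x)]

/-- The products `c_a c_b` with `a < b` reduce to `c_2`, `-c_1`, `c_0`; antisymmetry absorbs the
sign by replacing `ω_02` with `-ω_20`. -/
lemma covDeriv_eq (A : S.GaugeField) (ψ : S.Spinor) {i : S.ι} (k : Fin 3) {x : M}
    (hx : x ∈ S.U i) :
    covDeriv A ψ i k x = mvfderiv (𝓡 3) (fun y ↦ ψ.val (S.sec i y)) x (S.e i k x) +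
      spinConn cliffEnd imagEnd (fun a b ↦ connForm (S.e i) k a b x) (formCoeff A i k x)
        (ψ.val (S.sec i x)) := by
  have hω (a b : Fin 3) : S.omega i k a b x = connForm (S.e i) k a b x := rfl
  have h0 : Finset.Ioi (0 : Fin 3) = {1, 2} := by decide
  have h1 : Finset.Ioi (1 : Fin 3) = {2} := by decide
  have h2 : Finset.Ioi (2 : Fin 3) = ∅ := by decide
  have hc := isCliffordModule_spin
  have hf : A.form i x (S.e i k x) = Complex.I * (formCoeff A i k x : ℂ) := form_eq A hx _
  have hreal (r : ℝ) (v : Spin2) : (r : ℂ) • v = r • v := rfl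
  rw [covDeriv, hf, add_assoc]
  congr 1
  simp only [Fin.sum_univ_three, h0, h1, h2, hω, ← cliffEnd_apply]
  rw [Finset.sum_pair (by decide), Finset.sum_singleton, Finset.sum_empty]
  simp only [hc.mul01, hc.mul02, hc.mul12, spinConn, LinearMap.add_apply, LinearMap.smul_apply,
    (S.isOrthoFrameOn i).connForm_antisymm hx k 0 2, imagEnd_apply, hreal]
  have h12 (v : Spin2) : (1 / 2 : ℂ) • v = (1 / 2 : ℝ) • v := by
    rw [← hreal]; norm_num
  rw [h12, h12, mul_comm Complex.I, mul_smul, hreal]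
  module

/-- At a point where `|ψ|²` has a local maximum, a monopole satisfies `s |ψ|² / 4 + |ψ|⁴ / 8 ≤ 0`. -/
lemma monopole_estimate {ψ : S.Spinor} {A : S.GaugeField} (hψ : ψ.IsC 2) (hA : A.IsC 2)
    (hm : IsMonopole ψ A) {i : S.ι} {x : M} (hx : x ∈ S.U i)
    (hmax : IsLocalMax (fun y ↦ ‖ψ.val (S.sec i y)‖ ^ 2) x) :
    1 / 4 * scalarCurvature x * ‖ψ.val (S.sec i x)‖ ^ 2 + 1 / 8 * ‖ψ.val (S.sec i x)‖ ^ 4 ≤ 0 := by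
  have hfr := S.isOrthoFrameOn i
  have hU : S.U i ∈ 𝓝 x := (S.isOpen_U i).mem_nhds hx
  set φ : M → Spin2 := fun y ↦ ψ.val (S.sec i y)
  have hφ {y : M} (hy : y ∈ S.U i) : ContMDiffAt (𝓡 3) 𝓘(ℝ, Spin2) 2 φ y :=
    (hψ i).contMDiffAt ((S.isOpen_U i).mem_nhds hy)
  have hφd {y : M} (hy : y ∈ S.U i) : MDifferentiableAt (𝓡 3) 𝓘(ℝ, Spin2) φ y :=
    (hφ hy).mdifferentiableAt (by norm_num)
  have hdφ (k : Fin 3) : MDifferentiableAt (𝓡 3) 𝓘(ℝ, Spin2)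
      (fun y ↦ mvfderiv (𝓡 3) φ y (S.e i k y)) x :=
    mdifferentiableAt_mvfderiv (hφ hx) (hfr.fieldDiffAt hx k)
  have hα (k : Fin 3) : MDifferentiableAt (𝓡 3) 𝓘(ℝ) (formCoeff A i k) x :=
    (((mdifferentiableAt_form A hA hx k).hasDirDeriv (S.e i 0 x)).clm_apply Complex.imCLM).1
  -- the components of the curvature of `A`
  have hF (k l : Fin 3) : curvature A i k l x =
      Complex.I * ((mvfderiv (𝓡 3) (formCoeff A i l) x (S.e i k x) -
        mvfderiv (𝓡 3) (formCoeff A i k) x (S.e i l x) -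
        ∑ j, (connForm (S.e i) k l j x - connForm (S.e i) l k j x) * formCoeff A i j x : ℝ) : ℂ) := by
    have hd (k l : Fin 3) : mvfderiv (𝓡 3) (fun y ↦ A.form i y (S.e i k y)) x (S.e i l x) =
        Complex.I * (mvfderiv (𝓡 3) (formCoeff A i k) x (S.e i l x) : ℂ) := by
      have h1 := ((hα k).hasDirDeriv (S.e i l x)).clm_apply
        ((ContinuousLinearMap.mul ℝ ℂ Complex.I).comp Complex.ofRealCLM)
      refine (h1.congr_of_eventuallyEq ?_).2
      filter_upwards [hU] with y hy
      exact form_eq A hy _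
    rw [curvature, hd, hd, hfr.mlieBracket_frame hx, map_sum]
    have (j : Fin 3) : A.form i x (S.e i j x) = Complex.I * (formCoeff A i j x : ℂ) :=
      form_eq A hx _
    simp only [map_smul, this]
    push_cast
    rw [mul_sub, mul_sub, Finset.mul_sum]
    congr 1
    refine Finset.sum_congr rfl fun j _ ↦ ?_
    rw [Complex.real_smul]
    push_cast
    ring
  -- the derivatives of `|φ|²`
  have hf1 {y : M} (hy : y ∈ S.U i) (v : TangentSpace (𝓡 3) y) :
      HasDirDeriv (fun y ↦ ‖φ y‖ ^ 2) y v (2 * inner ℝ (mvfderiv (𝓡 3) φ y v) (φ y)) := by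
    have h := ((hφd hy).hasDirDeriv v).inner ((hφd hy).hasDirDeriv v)
    simp only [real_inner_self_eq_norm_sq] at h
    rwa [real_inner_comm (mvfderiv (𝓡 3) φ y v) (φ y), ← two_mul] at h
  have hf2 : ContMDiffAt (𝓡 3) 𝓘(ℝ) 2 (fun y ↦ ‖φ y‖ ^ 2) x :=
    ((contDiff_norm_sq ℝ (E := Spin2) (n := 2)).contMDiff.contMDiffAt).comp x (hφ hx)
  have hdf (k : Fin 3) : HasDirDeriv
      (fun y ↦ mvfderiv (𝓡 3) (fun z ↦ ‖φ z‖ ^ 2) y (S.e i k y)) x (S.e i k x)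
      (2 * (inner ℝ (mvfderiv (𝓡 3) (fun y ↦ mvfderiv (𝓡 3) φ y (S.e i k y)) x (S.e i k x)) (φ x) +
        ‖mvfderiv (𝓡 3) φ x (S.e i k x)‖ ^ 2)) := by
    have h := (HasDirDeriv.const (2 : ℝ) (S.e i k x)).mul (((hdφ k).hasDirDeriv (S.e i k x)).inner
      ((hφd hx).hasDirDeriv (S.e i k x)))
    rw [real_inner_self_eq_norm_sq, zero_mul, zero_add] at h
    refine h.congr_of_eventuallyEq ?_
    filter_upwards [hU] with y hy using (hf1 hy _).2
  -- With the coefficients supplied below, `curvCoeff` is `curvOf` by definition.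
  rw [hfr.scalarCurvature_eq hx]
  refine IsCliffordModule.curvature_estimate (fun k a b ↦ connForm (S.e i) k a b x)
    (fun l k a b ↦ mvfderiv (𝓡 3) (connForm (S.e i) k a b) x (S.e i l x))
    (fun k ↦ formCoeff A i k x) (fun l k ↦ mvfderiv (𝓡 3) (formCoeff A i k) x (S.e i l x))
    (φ x) (fun k ↦ mvfderiv (𝓡 3) φ x (S.e i k x))
    (fun l k ↦ mvfderiv (𝓡 3) (fun y ↦ mvfderiv (𝓡 3) φ y (S.e i k y)) x (S.e i l x))
    isCliffordModule_spin (hfr.connForm_antisymm hx) ?_ ?_ ?_ ?_ ?_ (sum_sq_inner_cliffEnd _) ?_ ?_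
  · intro l k a b
    have : connForm (S.e i) k a b =ᶠ[𝓝 x] -connForm (S.e i) k b a := by
      filter_upwards [hU] with y hy using hfr.connForm_antisymm hy k a b
    rw [mvfderiv_congr this, mvfderiv_neg]
    rfl
  · intro l k
    rw [mvfderiv_comm (hφ hx) (hfr.fieldDiffAt hx l) (hfr.fieldDiffAt hx k),
      hfr.mlieBracket_frame hx, map_sum]
    simp only [map_smul]
  · have h := (hm i x hx).1
    simp only [dirac, covDeriv_eq A ψ _ hx, ← cliffEnd_apply] at h
    exact h
  · intro l
    have h (k : Fin 3) := (((hdφ k).hasDirDeriv (S.e i l x)).add (HasDirDeriv.spinConn cliffEnd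
      imagEnd (fun a b ↦ (hfr.mdifferentiableAt_connForm hx k a b).hasDirDeriv (S.e i l x))
      ((hα k).hasDirDeriv _) ((hφd hx).hasDirDeriv _))).linearMap_apply (cliffEnd k)
    have hsum := HasDirDeriv.sum (s := Finset.univ) fun k _ ↦ h k
    -- The Dirac equation holds on all of `U i`, so its derivative along `e_l` vanishes as well.
    have h0 := (HasDirDeriv.const (0 : Spin2) (S.e i l x)).congr_of_eventuallyEq (g := fun y ↦
      ∑ k, cliffEnd k (mvfderiv (𝓡 3) φ y (S.e i k y) + spinConn cliffEnd imagEnd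
        (fun a b ↦ connForm (S.e i) k a b y) (formCoeff A i k y) (φ y))) (by
        filter_upwards [hU] with y hy
        have h := (hm i y hy).1
        simp only [dirac, covDeriv_eq A ψ _ hy, ← cliffEnd_apply] at h
        exact h)
    exact hsum.2.symm.trans h0.2
  · intro m
    have h := (hm i x hx).2 m
    rw [starCurvature, hF, quadMap_eq] at h
    exact_mod_cast mul_left_cancel₀ Complex.I_ne_zero h
  · intro k
    have h := mvfderiv_eq_zero_of_isLocalMax (hf1 hx (S.e i k x)).1 hmax (S.e i k x)
    rw [(hf1 hx _).2] at h
    linarith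
  · intro k
    have h := mvfderiv_mvfderiv_nonpos_of_isLocalMax hf2 hmax (hfr.fieldDiffAt hx k)
    rw [(hdf k).2] at h
    linarith

end SpinCStructure

/-! ### The pointwise norm and the global bound -/

namespace SpinCStructure

variable {M : Type*} [TopologicalSpace M] [ChartedSpace E3 M] [IsManifold (𝓡 3) ∞ M]
  [Bundle.RiemannianBundle (fun x : M ↦ TangentSpace (𝓡 3) x)]
  {o : ManifoldOrientation M} {S : SpinCStructure o}

/-- Points of one fibre differ by an element of `Spin^c(3)`, which acts on spinors unitarily. -/
lemma norm_val_eq (ψ : S.Spinor) {x : M} (p q : S.P x) : ‖ψ.val p‖ = ‖ψ.val q‖ := by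
  obtain ⟨g, rfl⟩ := S.transitive p q
  rw [ψ.equivariant]
  exact (norm_matAct_of_mem_unitaryGroup (spinRep_mem_unitaryGroup g⁻¹) _).symm

/-- The pointwise norm of a spinor. -/
def Spinor.normAt (ψ : S.Spinor) (x : M) : ℝ := ‖ψ.val (S.sec (S.cover x).choose x)‖

lemma Spinor.norm_val (ψ : S.Spinor) {x : M} (p : S.P x) : ‖ψ.val p‖ = ψ.normAt x :=
  norm_val_eq ψ p _

lemma Spinor.continuous_normAt {ψ : S.Spinor} {n : ℕ∞ω} (hψ : ψ.IsC n) : Continuous ψ.normAt := by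
  rw [continuous_iff_continuousAt]
  intro x
  obtain ⟨i, hi⟩ := S.cover x
  have h : ContinuousAt (fun y ↦ ‖ψ.val (S.sec i y)‖) x :=
    ((hψ i).continuousOn.continuousAt ((S.isOpen_U i).mem_nhds hi)).norm
  simpa only [ψ.norm_val] using h

/-- A gauge field together with the zero spinor is reducible. -/
lemma isReducible_of_eq_zero [Nonempty M] {ψ : S.Spinor} (A : S.GaugeField)
    (hψ : ∀ (x : M) (p : S.P x), ψ.val p = 0) : IsReducible ψ A := by
  -- A constant gauge transformation leaves `A` unchanged because `dγ = 0`, and every gauge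
  -- transformation fixes the zero spinor.
  let γ : GaugeGroup M := ContMDiffMap.const (-1)
  have hγ : gaugeVal γ = fun _ ↦ -1 := by
    funext x
    change ((-1 : Circle) : ℂ) = -1
    simp
  refine ⟨γ, ?_, ?_, ?_⟩
  · intro h
    obtain ⟨x⟩ := ‹Nonempty M›
    have h1 := congrFun hγ x
    rw [h] at h1
    simp [gaugeVal] at h1
    norm_num at h1
  · ext x p
    simp [gaugeSpinor, hψ]
  · ext i x v
    simp [gaugeGaugeField, hγ, mvfderiv_const]

variable [IsContMDiffRiemannianBundle (𝓡 3) ∞ E3 (fun x : M ↦ TangentSpace (𝓡 3) x)]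

lemma continuous_scalarCurvature (S : SpinCStructure o) :
    Continuous (scalarCurvature (M := M)) := by
  rw [continuous_iff_continuousAt]
  intro x
  obtain ⟨i, hi⟩ := S.cover x
  exact (S.isOrthoFrameOn i).continuousAt_scalarCurvature hi

/-- The pointwise norm of the spinor of a monopole is bounded in terms of a lower bound of the scalar
curvature. -/
lemma normAt_sq_le [CompactSpace M] [Nonempty M] {ψ : S.Spinor} {A : S.GaugeField} (hψ : ψ.IsC 2)
    (hA : A.IsC 2) (hm : IsMonopole ψ A) {m : ℝ} (hs : ∀ x : M, m ≤ scalarCurvature x) (x : M) :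
    ψ.normAt x ^ 2 ≤ max 0 (-2 * m) := by
  obtain ⟨x₀, -, hx₀⟩ := isCompact_univ.exists_isMaxOn (Set.univ_nonempty (α := M))
    ((Spinor.continuous_normAt hψ).pow 2).continuousOn
  have hmax (y : M) : ψ.normAt y ^ 2 ≤ ψ.normAt x₀ ^ 2 := hx₀ (Set.mem_univ y)
  refine (hmax x).trans ?_
  obtain ⟨i, hi⟩ := S.cover x₀
  have hest := monopole_estimate hψ hA hm hi (Eventually.of_forall fun y ↦ by
    simpa only [ψ.norm_val] using hmax y)
  rw [ψ.norm_val] at hest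
  have h0 : 0 ≤ ψ.normAt x₀ ^ 2 := sq_nonneg _
  set t := ψ.normAt x₀ ^ 2 with ht
  have h4 : ψ.normAt x₀ ^ 4 = t * t := by rw [ht]; ring
  rw [h4] at hest
  rcases h0.eq_or_lt with h | h
  · rw [← h]
    exact le_max_left _ _
  · refine le_max_of_le_right ?_
    -- Eight times the estimate; dividing by `t > 0` leaves `t ≤ -2 s(x₀)`.
    have hfac : t * (2 * scalarCurvature x₀ + t) ≤ 0 := by linarith
    have := nonpos_of_mul_nonpos_right hfac h
    linarith [hs x₀]

end SpinCStructure

end SeibergWitten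

end

theorem mainTheorem8
    {M : Type*} [TopologicalSpace M] [ChartedSpace (EuclideanSpace ℝ (Fin 3)) M]
    [IsManifold (𝓡 3) ∞ M] [T2Space M] [CompactSpace M] [ConnectedSpace M]
    [Bundle.RiemannianBundle (fun x : M ↦ TangentSpace (𝓡 3) x)]
    [IsContMDiffRiemannianBundle (𝓡 3) ∞ (EuclideanSpace ℝ (Fin 3))
      (fun x : M ↦ TangentSpace (𝓡 3) x)]
    (o : SeibergWitten.ManifoldOrientation M) (S : SeibergWitten.SpinCStructure o)
    (ψ : S.Spinor) (A : S.GaugeField) (hψ : ψ.IsC 2) (hA : A.IsC 2)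
    (h : SeibergWitten.SpinCStructure.IsMonopole ψ A) :
    (∃ m : ℝ, IsLeast (Set.range (SeibergWitten.scalarCurvature (M := M))) m ∧
      IsGreatest (Set.range fun x : M ↦ -2 * SeibergWitten.scalarCurvature x) (-2 * m) ∧
      BddAbove (Set.range fun q : (x : M) × S.P x ↦ ‖ψ.val q.2‖) ∧
      ψ.supNorm ^ 2 ≤ max 0 (-2 * m)) ∧
    ((∀ x : M, 0 ≤ SeibergWitten.scalarCurvature x) →
      (∀ (x : M) (p : S.P x), ψ.val p = 0) ∧ SeibergWitten.SpinCStructure.IsReducible ψ A) := by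
  obtain ⟨x₀, -, hx₀⟩ := isCompact_univ.exists_isMinOn (Set.univ_nonempty (α := M))
    S.continuous_scalarCurvature.continuousOn
  have hmin (y : M) : SeibergWitten.scalarCurvature x₀ ≤ SeibergWitten.scalarCurvature y :=
    hx₀ (Set.mem_univ y)
  -- Kept for an arbitrary lower bound `m`: the minimum of `s` gives the norm bound, and `m = 0`
  -- gives the vanishing.
  have hnorm (m : ℝ) (hm : ∀ y : M, m ≤ SeibergWitten.scalarCurvature y) (x : M) (p : S.P x) :
      ‖ψ.val p‖ ^ 2 ≤ max 0 (-2 * m) := by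
    rw [ψ.norm_val]
    exact SeibergWitten.SpinCStructure.normAt_sq_le hψ hA h hm x
  refine ⟨⟨SeibergWitten.scalarCurvature x₀, ⟨⟨x₀, rfl⟩, ?_⟩, ⟨⟨x₀, rfl⟩, ?_⟩, ?_, ?_⟩, ?_⟩
  · rintro _ ⟨y, rfl⟩
    exact hmin y
  · rintro _ ⟨y, rfl⟩
    linarith [hmin y]
  -- Boundedness ensures that the real supremum in `supNorm` is a genuine one and not the default
  -- value `0`.
  · refine ⟨√(max 0 (-2 * SeibergWitten.scalarCurvature x₀)), ?_⟩
    rintro _ ⟨⟨x, p⟩, rfl⟩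
    exact Real.le_sqrt_of_sq_le (hnorm _ hmin x p)
  · rw [← Real.sq_sqrt (le_max_left 0 (-2 * SeibergWitten.scalarCurvature x₀))]
    refine pow_le_pow_left₀ (Real.iSup_nonneg fun _ ↦ norm_nonneg _) ?_ 2
    exact Real.iSup_le (fun q ↦ Real.le_sqrt_of_sq_le (hnorm _ hmin q.1 q.2)) (Real.sqrt_nonneg _)
  · intro hs
    have hzero (x : M) (p : S.P x) : ψ.val p = 0 := by
      have := hnorm 0 hs x p
      rw [mul_zero, max_self] at this
      exact norm_eq_zero.1 (pow_eq_zero_iff two_ne_zero |>.1 (le_antisymm this (sq_nonneg _)))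
    exact ⟨hzero, SeibergWitten.SpinCStructure.isReducible_of_eq_zero A hzero⟩
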